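/- For $N\ge 1$ and $\underline\zeta\in\mathbb{R}^N$ let $\lambda_N(\underline\zeta)\in[-\infty,\infty]$ (respectively $\widehat\lambda_N(\underline\zeta)$) denote the supremum of the real numbers $\lambda$ such that the system $$1\le |x|\le X,\qquad \max_{1\le j\le N}|\zeta_j x-y_j|\le X^{-\lambda}$$ has a solution $(x,y_1,\ldots,y_N)\in\mathbb{Z}^{N+1}$ for arbitrarily large real $X$ (respectively for all sufficiently large real $X$). Theorem. Let $k\ge n\ge 2$ be integers and let $\underline\xi=(\xi_1,\xi_2,\ldots)$ be an infinite vector of real numbers such that $1,\xi_1,\ldots,\xi_k$ are linearly independent over $\mathbb{Q}$. Write $\underline\xi_N=(\xi_1,\ldots,\xi_N)$, $\lambda_n=\lambda_n(\underline\xi_n)$ and $\widehat\lambda_n=\widehat\lambda_n(\underline\xi_n)$. Then $\widehat\lambda_n$ is a real number with $\frac1n\le\widehat\lambda_n\le 1$, $$\lambda_k(\underline\xi_k)\ \ge\ \frac{(n-1)\lambda_n+\widehat\lambda_n+n-2}{(k-1)(n-1)\lambda_n-\widehat\lambda_n+kn-n-k+2},$$ and moreover $$\lambda_k(\underline\xi_k)\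 \ge\ \frac{(A-1)B}{((k-2)A+1)B+(k-1)A},$$ where $$A=\frac{(n-1)(k-1)^2}{nk-k-2n+3-\widehat\lambda_n},\qquad B=\frac{(n-1)\lambda_n+\widehat\lambda_n+n-2}{1-\widehat\lambda_n}.$$ Here $A=\infty$ if its denominator vanishes (which happens only for $n=k=2$, $\widehat\lambda_n=1$), $B=\infty$ if $\lambda_n=\infty$ or $\widehat\lambda_n=1$, and the two bounds are extended to infinite values by their limits: the first is $\frac1{k-1}$ if $\lambda_n=\infty$; the second is $\frac{A-1}{(k-2)A+1}$ if $B=\infty>A$, and $\infty$ if $A=B=\infty$ (so that $k=2$). -/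

import Mathlib

open Filter

/-- The system `1 ≤ |x| ≤ X`, `max_j |ξ_j x - y_j| ≤ X ^ (-μ)` has a solution in integers
`x, y_1, …, y_N`. -/
def SimulSolvable {N : ℕ} (ξ : Fin N → ℝ) (μ X : ℝ) : Prop :=
  ∃ (x : ℤ) (y : Fin N → ℤ), 1 ≤ |x| ∧ ((|x| : ℤ) : ℝ) ≤ X ∧
    ∀ j, |ξ j * (x : ℝ) - (y j : ℝ)| ≤ X ^ (-μ)

/-- The ordinary exponent of simultaneous approximation, with values in `[-∞, ∞]`: the supremum
of all real `μ` such that the system is solvable for arbitrarily large real `X`. -/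
noncomputable def ordinaryExponent {N : ℕ} (ξ : Fin N → ℝ) : EReal :=
  sSup {e : EReal | ∃ μ : ℝ, e = (μ : EReal) ∧ ∃ᶠ X : ℝ in atTop, SimulSolvable ξ μ X}

/-- The uniform exponent of simultaneous approximation: the supremum of all real `μ` such that
the system is solvable for all sufficiently large real `X`. -/
noncomputable def uniformExponent {N : ℕ} (ξ : Fin N → ℝ) : EReal :=
  sSup {e : EReal | ∃ μ : ℝ, e = (μ : EReal) ∧ ∀ᶠ X : ℝ in atTop, SimulSolvable ξ μ X}

/-- The first `N` coordinates of an infinite vector; `ξ i` is the coordinate with number `i + 1`. -/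
def firstCoords (ξ : ℕ → ℝ) (N : ℕ) : Fin N → ℝ := fun i => ξ i

/-- The first lower bound, as a function of the ordinary exponent `l` and the uniform exponent `h`
of the first `n` coordinates. At `l = ∞` it is the limit as `l → ∞`. -/
noncomputable def firstBound (k n : ℕ) (l : EReal) (h : ℝ) : EReal :=
  if l = ⊤ then ((1 / ((k : ℝ) - 1) : ℝ) : EReal)
  else (((((n : ℝ) - 1) * l.toReal + h + n - 2) /
    (((k : ℝ) - 1) * ((n : ℝ) - 1) * l.toReal - h + k * n - n - k + 2) : ℝ) : EReal)

/-- The quantity `A`. For `2 ≤ n ≤ k` and `h ≤ 1` the numerator is positive and the denominator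
is nonnegative; the value is `∞` where the denominator vanishes (only `n = k = 2`, `h = 1`). -/
noncomputable def quantityA (k n : ℕ) (h : ℝ) : EReal :=
  if (n : ℝ) * k - k - 2 * n + 3 - h = 0 then ⊤
  else (((((n : ℝ) - 1) * ((k : ℝ) - 1) ^ 2) / ((n : ℝ) * k - k - 2 * n + 3 - h) : ℝ) : EReal)

/-- The quantity `B`, with value `∞` if the ordinary exponent `l` is infinite or if the
denominator `1 - h` vanishes. -/
noncomputable def quantityB (n : ℕ) (l : EReal) (h : ℝ) : EReal :=
  if l = ⊤ ∨ h = 1 then ⊤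
  else (((((n : ℝ) - 1) * l.toReal + h + n - 2) / (1 - h) : ℝ) : EReal)

/-- The expression `(A - 1) B / (((k - 2) A + 1) B + (k - 1) A)`, extended by its limits to
infinite values of `A` and `B`. -/
noncomputable def secondBound (k : ℕ) (A B : EReal) : EReal :=
  if A = ⊤ then
    if B = ⊤ then
      if k = 2 then ⊤ else ((1 / ((k : ℝ) - 2) : ℝ) : EReal)
    else ((B.toReal / (((k : ℝ) - 2) * B.toReal + ((k : ℝ) - 1)) : ℝ) : EReal)
  else
    if B = ⊤ then (((A.toReal - 1) / (((k : ℝ) - 2) * A.toReal + 1) : ℝ) : EReal)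
    else (((A.toReal - 1) * B.toReal /
      ((((k : ℝ) - 2) * A.toReal + 1) * B.toReal + ((k : ℝ) - 1) * A.toReal) : ℝ) : EReal)

/-! The bounds come from passing to the dual problem, making the linear form `a₀ + a₁ξ₁ + … +
a_Nξ_N` small, and back. Enlarging `n` to `k` is harmless there: an integral coefficient vector
padded with zeros keeps its value and its height, so exponents of linear forms cannot decrease. Let
`w`, `ŵ` denote the ordinary and uniform exponents of linear forms, and `λ`, `λ̂` those of
simultaneous approximation.

In dimension `n` simultaneous approximation gives `w_n ≥ ((n-1)λ_n + λ̂_n + n - 2)/(1 - λ̂_n) = B`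
and `ŵ_n ≥ (n-1)/(1 - λ̂_n)`; both pass to `k`. Conversely, in dimension `k`, inverses `a ≥ 1/ŵ_k`
and `b ≥ 1/w_k` give `λ_k ≥ (1-a)/((1+b)(k-1) - (1-a))`. With `b = 1/B`, the Dirichlet value `a =
1/k` yields the first bound and `a = 1/A` the second. Here `ŵ_k ≥ A` is found by going round once
more: `ŵ_k ≥ ŵ_n` gives `λ̂_k ≥ (1 - 1/ŵ_n)/(k-1)`, and then `ŵ_k ≥ (k-1)/(1 - λ̂_k)`.

Each transference takes two consecutive minimal points of one problem and seeks an integral point of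
the other orthogonal to both, or sometimes to one. Orthogonality is obtained from Minkowski's
theorem (`minkowski_linear_forms`): a scalar product is an integer, so bounding it by `1/2` makes it
vanish. The lemmas that carry this are `exists_orthogonal_two` and `exists_small_of_pair`. -/

/-! ### Geometry of numbers and determinants -/

/-- **Minkowski's linear forms theorem.** -/
theorem minkowski_linear_forms {ι : Type*} [Fintype ι] [DecidableEq ι] [Nonempty ι]
    (A : Matrix ι ι ℝ) (hA : A.det ≠ 0) (c : ι → ℝ) (hc : ∀ i, 0 ≤ c i)
    (h : |A.det| ≤ ∏ i, c i) :
    ∃ z : ι → ℤ, z ≠ 0 ∧ ∀ i, |A.mulVec (fun j => (z j : ℝ)) i| ≤ c i := by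
  classical
  let e := Matrix.toLin'OfInv (M := A) (M' := A⁻¹)
    (Matrix.mul_nonsing_inv _ (isUnit_iff_ne_zero.mpr hA))
    (Matrix.nonsing_inv_mul _ (isUnit_iff_ne_zero.mpr hA))
  let b : Module.Basis ι ℝ (ι → ℝ) := (Pi.basisFun ℝ ι).map e.symm
  have hb : ∀ i, b i = A.col i := by
    intro i
    simp [b, e, Matrix.toLin'OfInv]
  have hdet : (Matrix.of b).det = A.det := by
    rw [← Matrix.det_transpose A]
    congr 1
    ext i j
    simp [hb]
  have : Countable (Submodule.span ℤ (Set.range b)).toAddSubgroup :=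
    inferInstanceAs (Countable (Submodule.span ℤ (Set.range b)))
  have key := MeasureTheory.exists_ne_zero_mem_lattice_of_measure_mul_two_pow_le_measure
    (μ := MeasureTheory.volume) (L := (Submodule.span ℤ (Set.range b)).toAddSubgroup)
    (s := Set.Icc (-c) c) (ZSpan.isAddFundamentalDomain b MeasureTheory.volume)
    (fun x hx => ⟨neg_le_neg hx.2, neg_le.mp hx.1⟩) (convex_Icc _ _) isCompact_Icc (by
      rw [ZSpan.volume_fundamentalDomain, Real.volume_Icc_pi, hdet,
        ← ENNReal.ofReal_prod_of_nonneg (fun i _ => by simpa using hc i)]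
      have : (2 : ENNReal) ^ Module.finrank ℝ (ι → ℝ) = ENNReal.ofReal (2 ^ Fintype.card ι) := by
        rw [ENNReal.ofReal_pow (by norm_num)]; simp
      rw [this, ← ENNReal.ofReal_mul (abs_nonneg _)]
      apply ENNReal.ofReal_le_ofReal
      have h2 : ∏ i, (c i - (-c) i) = (∏ i, c i) * 2 ^ Fintype.card ι := by
        rw [← Finset.card_univ, ← Finset.prod_const, ← Finset.prod_mul_distrib]
        exact Finset.prod_congr rfl fun i _ => by simp only [Pi.neg_apply]; ring
      rw [h2]
      gcongr)
  obtain ⟨⟨x, hxL⟩, hx0, hx⟩ := key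
  have hxL' : x ∈ Submodule.span ℤ (Set.range b) := hxL
  obtain ⟨z, rfl⟩ := (Submodule.mem_span_range_iff_exists_fun ℤ).1 hxL'
  have hz : ∑ i, z i • b i = A.mulVec (fun j => (z j : ℝ)) := by
    ext i
    simp [hb, Matrix.mulVec, dotProduct, mul_comm]
  refine ⟨z, ?_, fun i => ?_⟩
  · rintro rfl
    exact hx0 (by simp)
  · rw [← hz]
    exact abs_le.mpr ⟨hx.1 i, hx.2 i⟩

/-- The matrix is a perturbation of the identity of rank at most two, so `det (1 + EV) = det (1 +
VE)` reduces the computation to a 2 × 2 determinant. -/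
theorem Matrix.det_updateRow_updateRow_one {ι : Type*} [Fintype ι] [DecidableEq ι] {p q : ι}
    (hpq : p ≠ q) (u v : ι → ℝ) :
    (((1 : Matrix ι ι ℝ).updateRow p u).updateRow q v).det = u p * v q - u q * v p := by
  have h : ((1 : Matrix ι ι ℝ).updateRow p u).updateRow q v =
      1 + (Matrix.of fun i (s : Fin 2) => if i = ![p, q] s then (1 : ℝ) else 0) *
        (Matrix.of ![u - Pi.single p 1, v - Pi.single q 1]) := by
    ext i j
    simp only [Matrix.updateRow_apply, Matrix.add_apply, Matrix.mul_apply, Fin.sum_univ_two,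
      Matrix.of_apply, Matrix.one_apply]
    by_cases hq : i = q
    · subst hq
      simp [hpq.symm, Pi.single_apply, eq_comm]
    · by_cases hp : i = p
      · subst hp
        simp [hpq, Pi.single_apply, eq_comm]
      · simp [hp, hq]
  have hE : ∀ (w : ι → ℝ) (s : Fin 2), Matrix.vecMul w
      (Matrix.of fun i (s : Fin 2) => if i = ![p, q] s then (1 : ℝ) else 0) s = w (![p, q] s) := by
    intro w s
    simp [Matrix.vecMul, dotProduct]
  rw [h, Matrix.det_one_add_mul_comm, Matrix.det_fin_two]
  simp [hE, hpq, hpq.symm]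

theorem Matrix.det_updateRow_one {ι : Type*} [Fintype ι] [DecidableEq ι] (p : ι) (u : ι → ℝ) :
    ((1 : Matrix ι ι ℝ).updateRow p u).det = u p := by
  have := Matrix.det_updateRow_sum (1 : Matrix ι ι ℝ) p u
  simp at this
  rw [← this]
  congr 2
  ext j
  simp [Matrix.one_apply]

theorem eq_zero_of_abs_le_half {r : ℝ} {m : ℤ} (hm : r = m) (hr : |r| ≤ 1 / 2) : r = 0 := by
  rw [hm] at hr ⊢
  have : |m| < 1 := by
    have : ((|m| : ℤ) : ℝ) < 1 := by push_cast; linarith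
    exact_mod_cast this
  simp [Int.abs_lt_one_iff.mp this]

/-- If `j₀` carries the largest coefficient of a vanishing sum, the corresponding term is
controlled by the others. -/
theorem abs_le_of_sum_eq {n : ℕ} {Δ f : Fin n → ℝ} {j₀ : Fin n} {s c : ℝ}
    (hmax : ∀ j, |Δ j| ≤ |Δ j₀|) (h0 : Δ j₀ ≠ 0) (hf : ∀ j ≠ j₀, |f j| ≤ c)
    (hs : |∑ j, Δ j * f j| ≤ |Δ j₀| * s) : |f j₀| ≤ (n - 1) * c + s := by
  have hn : 1 ≤ n := by have := j₀.isLt; omega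
  have h1 := Finset.add_sum_erase Finset.univ (fun j => Δ j * f j) (Finset.mem_univ j₀)
  have h2 : |∑ j ∈ Finset.univ.erase j₀, Δ j * f j| ≤ (n - 1) * (|Δ j₀| * c) := by
    calc _ ≤ ∑ j ∈ Finset.univ.erase j₀, |Δ j * f j| := Finset.abs_sum_le_sum_abs _ _
      _ ≤ ∑ j ∈ Finset.univ.erase j₀, |Δ j₀| * c := by
          refine Finset.sum_le_sum fun j hj => ?_
          rw [abs_mul]
          exact mul_le_mul (hmax j) (hf j (Finset.ne_of_mem_erase hj)) (abs_nonneg _) (abs_nonneg _)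
      _ = _ := by
          rw [Finset.sum_const, Finset.card_erase_of_mem (Finset.mem_univ _), nsmul_eq_mul]
          simp [Nat.cast_sub hn]
  have h3 : |Δ j₀| * |f j₀| ≤ |Δ j₀| * ((n - 1) * c + s) := by
    rw [← abs_mul]
    have : Δ j₀ * f j₀ = (∑ j, Δ j * f j) - ∑ j ∈ Finset.univ.erase j₀, Δ j * f j := by
      rw [← h1]; ring
    rw [this]
    refine (abs_sub _ _).trans ?_
    linarith
  exact le_of_mul_le_mul_left h3 (abs_pos.mpr h0)

theorem prod_ite_eq_mul_pow {n : ℕ} (j₀ : Fin n) (a c : ℝ) :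
    ∏ j : Fin n, (if j = j₀ then a else c) = a * c ^ (n - 1) := by
  rw [← Finset.mul_prod_erase _ _ (Finset.mem_univ j₀), if_pos rfl,
    Finset.prod_congr rfl fun j hj => if_neg (Finset.ne_of_mem_erase hj), Finset.prod_const,
    Finset.card_erase_of_mem (Finset.mem_univ _)]
  simp

/-! ### Integral points orthogonal to integral forms -/

section forms

variable {n : ℕ} {F : Matrix (Unit ⊕ Fin n) (Unit ⊕ Fin n) ℝ}

/-- The linear form with coefficients `(u₀, u₁)` in the coordinates `F` takes integral values. -/
def IntegralForm (F : Matrix (Unit ⊕ Fin n) (Unit ⊕ Fin n) ℝ) (u₀ : ℝ) (u₁ : Fin n → ℝ) : Prop :=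
  ∀ z : Unit ⊕ Fin n → ℤ, ∃ m : ℤ, u₀ * F.mulVec (fun i => (z i : ℝ)) (Sum.inl ()) +
    ∑ j, u₁ j * F.mulVec (fun i => (z i : ℝ)) (Sum.inr j) = m

/-- Integral points orthogonal to two independent integral forms. -/
theorem exists_orthogonal_two (hF : |F.det| = 1) {u₀ v₀ : ℝ} {u₁ v₁ : Fin n → ℝ}
    (hu : IntegralForm F u₀ u₁) (hv : IntegralForm F v₀ v₁) {D c : ℝ} (hc : 0 < c)
    (hD : ∀ j, |u₀ * v₁ j - u₁ j * v₀| ≤ D) (hne : ∃ j, u₀ * v₁ j - u₁ j * v₀ ≠ 0)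
    (h : 4 * D ≤ c ^ (n - 1)) :
    ∃ z : Unit ⊕ Fin n → ℤ, z ≠ 0 ∧
      u₀ * F.mulVec (fun i => (z i : ℝ)) (Sum.inl ()) +
        ∑ j, u₁ j * F.mulVec (fun i => (z i : ℝ)) (Sum.inr j) = 0 ∧
      ∀ j, |F.mulVec (fun i => (z i : ℝ)) (Sum.inr j)| ≤ n * c := by
  obtain ⟨j₁, hj₁⟩ := hne
  have : Nonempty (Fin n) := ⟨j₁⟩
  -- The forms `u` and `v` replace the rows `inl ()` and `inr j₀`, so the determinant is the largest
  -- minor. The box is `1/2` in these two rows, where integrality forces zero, and `c` in the other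
  -- `n - 1`; hence the condition `4 * D ≤ c ^ (n - 1)`.
  obtain ⟨j₀, hmax⟩ := Finite.exists_max fun j => |u₀ * v₁ j - u₁ j * v₀|
  have h0 : u₀ * v₁ j₀ - u₁ j₀ * v₀ ≠ 0 :=
    abs_pos.mp ((abs_pos.mpr hj₁).trans_le (hmax j₁))
  set W := ((1 : Matrix (Unit ⊕ Fin n) (Unit ⊕ Fin n) ℝ).updateRow (Sum.inl ())
    (Sum.elim (fun _ => u₀) u₁)).updateRow (Sum.inr j₀) (Sum.elim (fun _ => v₀) v₁) with hW
  have hWdet : W.det = u₀ * v₁ j₀ - u₁ j₀ * v₀ := by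
    rw [hW, Matrix.det_updateRow_updateRow_one (by simp)]; simp
  have hdet : |(W * F).det| = |u₀ * v₁ j₀ - u₁ j₀ * v₀| := by
    rw [Matrix.det_mul, abs_mul, hF, mul_one, hWdet]
  obtain ⟨z, hz, hzb⟩ := minkowski_linear_forms (W * F)
    (abs_pos.mp (hdet ▸ abs_pos.mpr h0))
    (Sum.elim (fun _ => 1 / 2) fun j => if j = j₀ then 1 / 2 else c)
    (by
      rintro (i | j)
      · norm_num
      · simp only [Sum.elim_inr]; split_ifs <;> [norm_num; exact hc.le])
    (by
      rw [hdet, Fintype.prod_sum_type]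
      simp only [Sum.elim_inl, Sum.elim_inr, prod_ite_eq_mul_pow]
      simp
      have := hD j₀
      linarith)
  refine ⟨z, hz, ?_⟩
  set f := F.mulVec (fun i => (z i : ℝ)) with hf
  have hA : (W * F).mulVec (fun i => (z i : ℝ)) = W.mulVec f := by
    rw [hf, Matrix.mulVec_mulVec]
  rw [hA] at hzb
  have hzu : u₀ * f (Sum.inl ()) + ∑ j, u₁ j * f (Sum.inr j) = 0 := by
    obtain ⟨m, hm⟩ := hu z
    refine eq_zero_of_abs_le_half hm ?_
    have := hzb (Sum.inl ())
    simpa [hW, Matrix.mulVec, dotProduct, Matrix.updateRow_apply] using this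
  have hzv : v₀ * f (Sum.inl ()) + ∑ j, v₁ j * f (Sum.inr j) = 0 := by
    obtain ⟨m, hm⟩ := hv z
    refine eq_zero_of_abs_le_half hm ?_
    have := hzb (Sum.inr j₀)
    simpa [hW, Matrix.mulVec, dotProduct, Matrix.updateRow_apply] using this
  have hzj : ∀ j ≠ j₀, |f (Sum.inr j)| ≤ c := by
    intro j hj
    have := hzb (Sum.inr j)
    simpa [hW, Matrix.mulVec, dotProduct, Matrix.updateRow_apply, hj, Matrix.one_apply] using this
  refine ⟨hzu, fun j => ?_⟩
  -- Eliminating the zeroth coordinate from the two equations leaves a relation whose coefficients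
  -- are the minors; it recovers the coordinate `j₀` that Minkowski's box did not bound.
  have hsum : ∑ j, (u₀ * v₁ j - u₁ j * v₀) * f (Sum.inr j) = 0 := by
    have : ∑ j, (u₀ * v₁ j - u₁ j * v₀) * f (Sum.inr j) =
        u₀ * (∑ j, v₁ j * f (Sum.inr j)) - v₀ * ∑ j, u₁ j * f (Sum.inr j) := by
      rw [Finset.mul_sum, Finset.mul_sum, ← Finset.sum_sub_distrib]
      exact Finset.sum_congr rfl fun j _ => by ring
    rw [this]
    linear_combination u₀ * hzv - v₀ * hzu
  have hn : (1 : ℝ) ≤ n := by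
    have : 1 ≤ n := by have := j₀.isLt; omega
    exact_mod_cast this
  by_cases hj : j = j₀
  · subst hj
    have := abs_le_of_sum_eq (s := 0) hmax h0 hzj (by simp [hsum])
    linarith
  · have := hzj j hj
    nlinarith

/-- Integral points orthogonal to one integral form. -/
theorem exists_orthogonal_one (hF : |F.det| = 1) {u₀ : ℝ} {u₁ : Fin n → ℝ}
    (hu : IntegralForm F u₀ u₁) {U c ε : ℝ} (hc : 0 < c) (hε : 0 < ε)
    (hU : ∀ j, |u₁ j| ≤ U) (hU' : ∃ j, |u₁ j| = U) (hUpos : 0 < U)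
    (h : 2 * U ≤ c ^ (n - 1) * ε) (hle : |u₀| * ε ≤ U * c) :
    ∃ z : Unit ⊕ Fin n → ℤ, z ≠ 0 ∧
      |F.mulVec (fun i => (z i : ℝ)) (Sum.inl ())| ≤ ε ∧
      ∀ j, |F.mulVec (fun i => (z i : ℝ)) (Sum.inr j)| ≤ n * c := by
  obtain ⟨j₀, hj₀⟩ := hU'
  have h0 : u₁ j₀ ≠ 0 := abs_pos.mp (hj₀ ▸ hUpos)
  set W := (1 : Matrix (Unit ⊕ Fin n) (Unit ⊕ Fin n) ℝ).updateRow (Sum.inr j₀)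
    (Sum.elim (fun _ => u₀) u₁) with hW
  have hdet : |(W * F).det| = U := by
    rw [Matrix.det_mul, abs_mul, hF, mul_one, hW, Matrix.det_updateRow_one]; simpa
  obtain ⟨z, hz, hzb⟩ := minkowski_linear_forms (W * F)
    (abs_pos.mp (hdet ▸ hUpos))
    (Sum.elim (fun _ => ε) fun j => if j = j₀ then 1 / 2 else c)
    (by
      rintro (i | j)
      · exact hε.le
      · simp only [Sum.elim_inr]; split_ifs <;> [norm_num; exact hc.le])
    (by
      rw [hdet, Fintype.prod_sum_type]
      simp only [Sum.elim_inl, Sum.elim_inr, prod_ite_eq_mul_pow]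
      simp
      linarith)
  refine ⟨z, hz, ?_⟩
  set f := F.mulVec (fun i => (z i : ℝ)) with hf
  have hA : (W * F).mulVec (fun i => (z i : ℝ)) = W.mulVec f := by
    rw [hf, Matrix.mulVec_mulVec]
  rw [hA] at hzb
  have hzu : u₀ * f (Sum.inl ()) + ∑ j, u₁ j * f (Sum.inr j) = 0 := by
    obtain ⟨m, hm⟩ := hu z
    refine eq_zero_of_abs_le_half hm ?_
    have := hzb (Sum.inr j₀)
    simpa [hW, Matrix.mulVec, dotProduct, Matrix.updateRow_apply] using this
  have hz0 : |f (Sum.inl ())| ≤ ε := by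
    have := hzb (Sum.inl ())
    simpa [hW, Matrix.mulVec, dotProduct, Matrix.updateRow_apply, Matrix.one_apply] using this
  have hzj : ∀ j ≠ j₀, |f (Sum.inr j)| ≤ c := by
    intro j hj
    have := hzb (Sum.inr j)
    simpa [hW, Matrix.mulVec, dotProduct, Matrix.updateRow_apply, hj, Matrix.one_apply] using this
  refine ⟨hz0, fun j => ?_⟩
  have hn : (1 : ℝ) ≤ n := by
    have : 1 ≤ n := by have := j₀.isLt; omega
    exact_mod_cast this
  by_cases hj : j = j₀
  · subst hj
    -- Here the relation is orthogonality to `u` itself; `hle` makes its zeroth term at most `U *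
    -- c`.
    have := abs_le_of_sum_eq (s := c) (fun i => hj₀ ▸ hU i) h0 hzj (by
      rw [hj₀, eq_neg_of_add_eq_zero_right hzu, abs_neg, abs_mul]
      exact (mul_le_mul_of_nonneg_left hz0 (abs_nonneg _)).trans hle)
    linarith
  · have := hzj j hj
    nlinarith

/-- A point orthogonal to `u` has its zeroth coordinate controlled by the others. -/
theorem abs_mul_le_of_orthogonal {u₀ f₀ U C : ℝ} {u₁ f₁ : Fin n → ℝ} (hU : ∀ j, |u₁ j| ≤ U)
    (h : u₀ * f₀ + ∑ j, u₁ j * f₁ j = 0) (hf : ∀ j, |f₁ j| ≤ C) :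
    |u₀| * |f₀| ≤ n * (U * C) := by
  rw [← abs_mul, eq_neg_of_add_eq_zero_left h, abs_neg]
  calc _ ≤ ∑ j, |u₁ j * f₁ j| := Finset.abs_sum_le_sum_abs _ _
    _ ≤ ∑ j : Fin n, U * C := by
        refine Finset.sum_le_sum fun j _ => ?_
        rw [abs_mul]
        exact mul_le_mul (hU j) (hf j) (abs_nonneg _) ((abs_nonneg _).trans (hU j))
    _ = _ := by simp

/-- The transference principle behind the inequalities between uniform exponents. -/
theorem exists_small_of_pair (hF : |F.det| = 1) {u₀ v₀ : ℝ} {u₁ v₁ : Fin n → ℝ}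
    (hu : IntegralForm F u₀ u₁) (hv : IntegralForm F v₀ v₁) {D c ε : ℝ} (hc : 0 < c) (hε : 0 < ε)
    (hD : ∀ j, |u₀ * v₁ j - u₁ j * v₀| ≤ D) (hne : ∃ j, u₀ * v₁ j - u₁ j * v₀ ≠ 0)
    (hu₀ : u₀ ≠ 0) (hu₁ : 0 < ‖u₁‖)
    (h : 4 * D ≤ c ^ (n - 1)) (h' : 2 * ‖u₁‖ ≤ c ^ (n - 1) * ε) :
    ∃ z : Unit ⊕ Fin n → ℤ, z ≠ 0 ∧
      |F.mulVec (fun i => (z i : ℝ)) (Sum.inl ())| ≤ n ^ 2 * ε ∧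
      ∀ j, |F.mulVec (fun i => (z i : ℝ)) (Sum.inr j)| ≤ n * c := by
  have hU : ∀ j, |u₁ j| ≤ ‖u₁‖ := norm_le_pi_norm u₁
  have hn : (1 : ℝ) ≤ n := by
    obtain ⟨j, -⟩ := hne
    have : 1 ≤ n := by have := j.isLt; omega
    exact_mod_cast this
  -- If `u₀` is relatively small, orthogonality to `u` alone suffices, with `ε` imposed directly.
  -- Otherwise a point orthogonal to both forms has small zeroth coordinate, because dividing by
  -- `u₀` is then cheap.
  rcases le_total (|u₀| * ε) (‖u₁‖ * c) with hle | hle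
  · have hex : ∃ j, |u₁ j| = ‖u₁‖ := by
      obtain ⟨j, -⟩ := hne
      have : Nonempty (Fin n) := ⟨j⟩
      obtain ⟨j₀, hmax⟩ := Finite.exists_max fun j => |u₁ j|
      exact ⟨j₀, le_antisymm (hU _) ((pi_norm_le_iff_of_nonneg (abs_nonneg _)).2 hmax)⟩
    obtain ⟨z, hz, h0, h1⟩ := exists_orthogonal_one hF hu hc hε hU hex hu₁ h' hle
    exact ⟨z, hz, h0.trans (le_mul_of_one_le_left hε.le (one_le_pow₀ hn)), h1⟩
  · obtain ⟨z, hz, h0, h1⟩ := exists_orthogonal_two hF hu hv hc hD hne h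
    refine ⟨z, hz, ?_, h1⟩
    have h2 := abs_mul_le_of_orthogonal hU h0 h1
    refine le_of_mul_le_mul_left (a := |u₀|) ?_ (abs_pos.mpr hu₀)
    calc _ ≤ _ := h2
      _ = n ^ 2 * (‖u₁‖ * c) := by ring
      _ ≤ n ^ 2 * (|u₀| * ε) := by gcongr
      _ = _ := by ring

end forms

/-! ### Minimal points -/

section minimal

variable {S : Type*}

theorem exists_forall_le_of_finite_sublevel {s : Set S} (hs : s.Nonempty) (g : S → ℝ)
    (hfin : ∀ c, {w | w ∈ s ∧ g w ≤ c}.Finite) : ∃ v ∈ s, ∀ w ∈ s, g v ≤ g w := by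
  obtain ⟨w₀, hw₀⟩ := hs
  obtain ⟨v, hv, hmin⟩ := Set.exists_min_image _ g (hfin (g w₀)) ⟨w₀, hw₀, le_rfl⟩
  refine ⟨v, hv.1, fun w hw => ?_⟩
  rcases le_total (g w) (g w₀) with h | h
  · exact hmin w ⟨hw, h⟩
  · exact hv.2.trans h

/-- Two consecutive minimal points for the size `N` and the error `L`. -/
structure MinimalPair (N L : S → ℝ) (v v' : S) : Prop where
  size_lt : N v < N v'
  error_lt : L v' < L v
  error_le : ∀ w, N w < N v' → L v ≤ L w

/-- A size function and an error function to which the theory of minimal points applies. -/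
structure ApproxSystem (N L : S → ℝ) : Prop where
  finite : ∀ Q c, {v | N v ≤ Q ∧ L v ≤ c}.Finite
  exists_small : ∀ ε > 0, ∃ v, L v < ε
  pos : ∀ v, 0 < L v

variable {N L : S → ℝ}

theorem ApproxSystem.exists_min (hS : ApproxSystem N L) {Q : ℝ} (hQ : ∃ w, N w ≤ Q) :
    ∃ v, N v ≤ Q ∧ ∀ w, N w ≤ Q → L v ≤ L w :=
  exists_forall_le_of_finite_sublevel (s := {w | N w ≤ Q}) hQ L (hS.finite Q)

/-- Take the best point up to size `Q`, then the smallest point that improves on it. -/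
theorem ApproxSystem.exists_pair_around (hS : ApproxSystem N L) {Q : ℝ} (hQ : ∃ w, N w ≤ Q) :
    ∃ v v', MinimalPair N L v v' ∧ N v ≤ Q ∧ Q < N v' := by
  obtain ⟨v, hv, hmin⟩ := hS.exists_min hQ
  obtain ⟨v', hv', hmin'⟩ := exists_forall_le_of_finite_sublevel (s := {w | L w < L v})
    (hS.exists_small _ (hS.pos v)) N
    (fun c => (hS.finite c (L v)).subset fun w hw => ⟨hw.2, le_of_lt hw.1⟩)
  have hQ' : Q < N v' := lt_of_not_ge fun h => (hmin v' h).not_gt hv'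
  exact ⟨v, v', ⟨hv.trans_lt hQ', hv', fun w hw => le_of_not_gt fun h => (hmin' w h).not_gt hw⟩,
    hv, hQ'⟩

/-- Here `v'` is the smallest among the best points up to size `Q`, and `v` is the best point
strictly smaller than `v'`. Once `Q` admits a point better than everything up to size `R`, the size
of `v'` must exceed `R`. -/
theorem ApproxSystem.exists_pair_below (hS : ApproxSystem N L) (R : ℝ) :
    ∀ᶠ Q in atTop, ∃ v v', MinimalPair N L v v' ∧ N v' ≤ Q ∧ (∀ w, N w ≤ Q → L v' ≤ L w) ∧
      R ≤ N v' := by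
  obtain ⟨w₀, -⟩ := hS.exists_small 1 one_pos
  obtain ⟨m, hm, hmmin⟩ := hS.exists_min (Q := max R (N w₀)) ⟨w₀, le_max_right _ _⟩
  obtain ⟨w₁, hw₁⟩ := hS.exists_small _ (hS.pos m)
  filter_upwards [eventually_ge_atTop (N w₁)] with Q hQ
  obtain ⟨v₁, hv₁, hv₁min⟩ := hS.exists_min ⟨w₁, hQ⟩
  obtain ⟨v', hv', hv'min⟩ := exists_forall_le_of_finite_sublevel
    (s := {w | N w ≤ Q ∧ L w ≤ L v₁}) ⟨v₁, hv₁, le_rfl⟩ N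
    (fun c => (hS.finite c (L v₁)).subset fun w hw => ⟨hw.2, hw.1.2⟩)
  have hbig : max R (N w₀) < N v' :=
    lt_of_not_ge fun h => (hmmin v' h).not_gt ((hv'.2.trans (hv₁min w₁ hQ)).trans_lt hw₁)
  obtain ⟨v, hv, hvmin⟩ := exists_forall_le_of_finite_sublevel (s := {w | N w < N v'})
    ⟨w₀, (le_max_right _ _).trans_lt hbig⟩ L
    (fun c => (hS.finite (N v') c).subset fun w hw => ⟨le_of_lt hw.1, hw.2⟩)
  have hv : N v < N v' := hv
  refine ⟨v, v', ⟨hv, lt_of_not_ge fun h => ?_, hvmin⟩, hv'.1,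
    fun w hw => hv'.2.trans (hv₁min w hw), (le_max_left _ _).trans hbig.le⟩
  exact (hv'min v ⟨hv.le.trans hv'.1, h.trans hv'.2⟩).not_gt hv

/-- Solvability of `N ≤ X`, `L ≤ X ^ (-μ)`. -/
def Solvable (N L : S → ℝ) (μ X : ℝ) : Prop := ∃ w, N w ≤ X ∧ L w ≤ X ^ (-μ)

theorem Solvable.mono {μ ν X : ℝ} (h : Solvable N L μ X) (hX : 1 ≤ X) (hν : ν ≤ μ) :
    Solvable N L ν X := by
  obtain ⟨w, h1, h2⟩ := h
  exact ⟨w, h1, h2.trans (Real.rpow_le_rpow_of_exponent_le hX (by linarith))⟩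

/-- Uniform solvability bounds the error of a minimal point by the size of its successor. -/
theorem MinimalPair.error_le_rpow {v v' : S} (hp : MinimalPair N L v v') {μ Q : ℝ} (hQ : 0 < Q)
    (h : ∀ X, Q ≤ X → Solvable N L μ X) (hQv : Q < N v') : L v ≤ N v' ^ (-μ) := by
  -- At `X = N v'` the solution could be `v'` itself, so the bound is proved for `X < N v'` and
  -- passed to the limit from the left.
  have ht : Tendsto (fun X : ℝ => X ^ (-μ)) (nhdsWithin (N v') (Set.Iio (N v')))
      (nhds (N v' ^ (-μ))) :=
    ((Real.continuousAt_rpow_const _ _ (Or.inl (hQ.trans hQv).ne')).tendsto).mono_left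
      nhdsWithin_le_nhds
  refine ge_of_tendsto ht ?_
  filter_upwards [Ioo_mem_nhdsLT hQv] with X hX
  obtain ⟨w, h1, h2⟩ := h X hX.1.le
  exact (hp.error_le w (h1.trans_lt hX.2)).trans h2

end minimal

/-! ### Simultaneous approximation and linear forms as dual problems -/

section forms

variable {n : ℕ}

/-- The value at `a` of the linear form with coefficients `1, ξ_1, …, ξ_n`. -/
def linValue (ξ : Fin n → ℝ) (a : Unit ⊕ Fin n → ℤ) : ℝ :=
  a (Sum.inl ()) + ∑ j, ξ j * a (Sum.inr j)

/-- The last coordinates of an integral vector. -/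
def tailVec (a : Unit ⊕ Fin n → ℤ) : Fin n → ℝ := fun j => a (Sum.inr j)

/-- The vector of errors of simultaneous approximation. -/
def simErr (ξ : Fin n → ℝ) (z : Unit ⊕ Fin n → ℤ) : Fin n → ℝ :=
  fun j => ξ j * z (Sum.inl ()) - z (Sum.inr j)

def simMatrix (ξ : Fin n → ℝ) : Matrix (Unit ⊕ Fin n) (Unit ⊕ Fin n) ℝ :=
  Matrix.fromBlocks 1 0 (Matrix.of fun j _ => ξ j) (-1)

def linMatrix (ξ : Fin n → ℝ) : Matrix (Unit ⊕ Fin n) (Unit ⊕ Fin n) ℝ :=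
  Matrix.fromBlocks 1 (Matrix.of fun _ j => ξ j) 0 1

variable (ξ : Fin n → ℝ)

theorem abs_det_simMatrix : |(simMatrix ξ).det| = 1 := by
  simp [simMatrix, Matrix.det_fromBlocks_zero₁₂, Matrix.det_neg, abs_pow]

theorem abs_det_linMatrix : |(linMatrix ξ).det| = 1 := by
  simp [linMatrix]

theorem simMatrix_mulVec_inl (z : Unit ⊕ Fin n → ℤ) :
    (simMatrix ξ).mulVec (fun i => (z i : ℝ)) (Sum.inl ()) = z (Sum.inl ()) := by
  simp [simMatrix, Matrix.mulVec, dotProduct]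

theorem simMatrix_mulVec_inr (z : Unit ⊕ Fin n → ℤ) (j : Fin n) :
    (simMatrix ξ).mulVec (fun i => (z i : ℝ)) (Sum.inr j) = simErr ξ z j := by
  simp [simMatrix, Matrix.mulVec, dotProduct, simErr, Matrix.one_apply, sub_eq_add_neg]

theorem linMatrix_mulVec_inl (z : Unit ⊕ Fin n → ℤ) :
    (linMatrix ξ).mulVec (fun i => (z i : ℝ)) (Sum.inl ()) = linValue ξ z := by
  simp [linMatrix, Matrix.mulVec, dotProduct, linValue]

theorem linMatrix_mulVec_inr (z : Unit ⊕ Fin n → ℤ) (j : Fin n) :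
    (linMatrix ξ).mulVec (fun i => (z i : ℝ)) (Sum.inr j) = tailVec z j := by
  simp [linMatrix, Matrix.mulVec, dotProduct, tailVec, Matrix.one_apply]

/-- The duality: the integral scalar product of `a` and `z` is expressed in the coordinates that
measure approximation on each side. Thus each point of one problem is an integral form on the other.
-/
theorem pairing_eq (a z : Unit ⊕ Fin n → ℤ) :
    (z (Sum.inl ()) : ℝ) * linValue ξ a - ∑ j, tailVec a j * simErr ξ z j = (∑ i, a i * z i : ℤ) := by
  simp only [linValue, simErr, tailVec, Fintype.sum_sum_type, mul_add, Finset.mul_sum, mul_sub,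
    Finset.sum_sub_distrib]
  push_cast
  simp only [Finset.univ_unique, Finset.sum_singleton]
  have : ∑ j, (z (Sum.inl ()) : ℝ) * (ξ j * a (Sum.inr j)) =
      ∑ j, (a (Sum.inr j) : ℝ) * (ξ j * z (Sum.inl ())) :=
    Finset.sum_congr rfl fun j _ => by ring
  rw [this]
  simp
  ring

theorem integralForm_lin (z : Unit ⊕ Fin n → ℤ) :
    IntegralForm (linMatrix ξ) (z (Sum.inl ())) (-simErr ξ z) := by
  intro a
  refine ⟨_, Eq.trans ?_ (pairing_eq ξ a z)⟩
  simp only [linMatrix_mulVec_inl, linMatrix_mulVec_inr, Pi.neg_apply, neg_mul,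
    Finset.sum_neg_distrib, ← sub_eq_add_neg]
  simp only [mul_comm]

theorem integralForm_sim (a : Unit ⊕ Fin n → ℤ) :
    IntegralForm (simMatrix ξ) (linValue ξ a) (-tailVec a) := by
  intro z
  refine ⟨_, Eq.trans ?_ (pairing_eq ξ a z)⟩
  simp only [simMatrix_mulVec_inl, simMatrix_mulVec_inr, Pi.neg_apply, neg_mul,
    Finset.sum_neg_distrib, ← sub_eq_add_neg]
  simp only [mul_comm]

/-- Integral vectors eligible for simultaneous approximation. -/
def SimPoint (n : ℕ) : Type := {z : Unit ⊕ Fin n → ℤ // z (Sum.inl ()) ≠ 0}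

/-- Integral vectors eligible for the approximation to zero by a linear form. -/
def LinPoint (n : ℕ) : Type := {a : Unit ⊕ Fin n → ℤ // tailVec a ≠ 0}

def SimPoint.size (z : SimPoint n) : ℝ := |(z.1 (Sum.inl ()) : ℝ)|

def SimPoint.error (ξ : Fin n → ℝ) (z : SimPoint n) : ℝ := ‖simErr ξ z.1‖

def LinPoint.size (a : LinPoint n) : ℝ := ‖tailVec a.1‖

def LinPoint.error (ξ : Fin n → ℝ) (a : LinPoint n) : ℝ := |linValue ξ a.1|

theorem simPoint_of_ne_zero {z : Unit ⊕ Fin n → ℤ} (hz : z ≠ 0) (h : ‖simErr ξ z‖ < 1) :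
    z (Sum.inl ()) ≠ 0 := by
  intro h0
  apply hz
  ext (i | j)
  · exact h0
  · have := (norm_le_pi_norm (simErr ξ z) j).trans_lt h
    simp only [simErr, h0, Int.cast_zero, mul_zero, zero_sub, norm_neg, Real.norm_eq_abs] at this
    exact Int.abs_lt_one_iff.mp (by exact_mod_cast this)

theorem linPoint_of_ne_zero {a : Unit ⊕ Fin n → ℤ} (ha : a ≠ 0) (h : |linValue ξ a| < 1) :
    tailVec a ≠ 0 := by
  intro h0
  have h1 : ∀ j, a (Sum.inr j) = 0 := fun j => by
    have := congrFun h0 j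
    simpa [tailVec] using this
  apply ha
  ext (i | j)
  · simp only [linValue, h1, Int.cast_zero, mul_zero, Finset.sum_const_zero, add_zero] at h
    exact Int.abs_lt_one_iff.mp (by exact_mod_cast h)
  · exact h1 j

theorem finite_setOf_abs_le {ι : Type*} [Fintype ι] (C : ℝ) :
    {z : ι → ℤ | ∀ i, |(z i : ℝ)| ≤ C}.Finite := by
  classical
  refine (Set.finite_Icc (fun _ : ι => -⌈C⌉) (fun _ => ⌈C⌉)).subset fun z hz => ?_
  have h : ∀ i, |z i| ≤ ⌈C⌉ := fun i => by
    have := (hz i).trans (Int.le_ceil C)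
    exact_mod_cast this
  exact ⟨fun i => (abs_le.mp (h i)).1, fun i => (abs_le.mp (h i)).2⟩

/-- Dirichlet's theorem, from a box of volume parameter `X * (X ^ (-1/n)) ^ n = 1`; errors below `1`
exclude a zero denominator. -/
theorem exists_simPoint [NeZero n] {X : ℝ} (hX : 1 < X) :
    Solvable SimPoint.size (SimPoint.error ξ) (1 / n) X := by
  have hX0 : 0 < X := by linarith
  have hn : (0 : ℝ) < n := by exact_mod_cast NeZero.pos n
  obtain ⟨z, hz, hb⟩ := minkowski_linear_forms (simMatrix ξ)
    (abs_pos.mp (by rw [abs_det_simMatrix]; exact one_pos))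
    (Sum.elim (fun _ => X) fun _ => X ^ (-(1 / (n : ℝ))))
    (by rintro (i | j) <;> simp <;> positivity)
    (by
      rw [abs_det_simMatrix, Fintype.prod_sum_type]
      simp only [Sum.elim_inl, Sum.elim_inr, Finset.prod_const, Finset.card_univ, Fintype.card_fin,
        Fintype.card_unit, pow_one]
      rw [← Real.rpow_natCast, ← Real.rpow_mul hX0.le]
      have : -(1 / (n : ℝ)) * n = -1 := by field_simp
      rw [this, Real.rpow_neg_one, mul_inv_cancel₀ hX0.ne'])
  have h0 := hb (Sum.inl ())
  have h1 : ‖simErr ξ z‖ ≤ X ^ (-(1 / (n : ℝ))) :=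
    (pi_norm_le_iff_of_nonneg (by positivity)).2 fun j => by
      have := hb (Sum.inr j)
      rwa [simMatrix_mulVec_inr] at this
  rw [simMatrix_mulVec_inl] at h0
  exact ⟨⟨z, simPoint_of_ne_zero ξ hz (h1.trans_lt
    (Real.rpow_lt_one_of_one_lt_of_neg hX (by simpa using NeZero.pos n)))⟩, h0, h1⟩

theorem exists_linPoint [NeZero n] {X : ℝ} (hX : 1 < X) :
    Solvable LinPoint.size (LinPoint.error ξ) n X := by
  have hX0 : 0 < X := by linarith
  have hn : (0 : ℝ) < n := by exact_mod_cast NeZero.pos n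
  obtain ⟨z, hz, hb⟩ := minkowski_linear_forms (linMatrix ξ)
    (abs_pos.mp (by rw [abs_det_linMatrix]; exact one_pos))
    (Sum.elim (fun _ => X ^ (-(n : ℝ))) fun _ => X)
    (by rintro (i | j) <;> simp <;> positivity)
    (by
      rw [abs_det_linMatrix, Fintype.prod_sum_type]
      simp only [Sum.elim_inl, Sum.elim_inr, Finset.prod_const, Finset.card_univ, Fintype.card_fin,
        Fintype.card_unit, pow_one]
      rw [← Real.rpow_natCast, ← Real.rpow_add hX0]
      simp)
  have h0 := hb (Sum.inl ())
  have h1 : ‖tailVec z‖ ≤ X :=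
    (pi_norm_le_iff_of_nonneg hX0.le).2 fun j => by
      have := hb (Sum.inr j)
      rwa [linMatrix_mulVec_inr] at this
  rw [linMatrix_mulVec_inl] at h0
  exact ⟨⟨z, linPoint_of_ne_zero ξ hz (h0.trans_lt
    (Real.rpow_lt_one_of_one_lt_of_neg hX (by simpa using NeZero.pos n)))⟩, h1, h0⟩

/-- Linear independence of `1, ξ_1, …, ξ_n` over the integers. -/
def IntIndep (ξ : Fin n → ℝ) : Prop := ∀ a, linValue ξ a = 0 → a = 0

variable {ξ}

theorem exists_error_lt {S : Type*} {N L : S → ℝ} {μ : ℝ} (hμ : 0 < μ)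
    (h : ∀ X, 1 < X → Solvable N L μ X) (ε : ℝ) (hε : 0 < ε) : ∃ v, L v < ε := by
  obtain ⟨X, hX, hX'⟩ := ((eventually_gt_atTop (1 : ℝ)).and
    ((tendsto_rpow_neg_atTop hμ).eventually_lt_const hε)).exists
  obtain ⟨w, -, hw⟩ := h X hX
  exact ⟨w, hw.trans_lt hX'⟩

/-- Independence enters only in the positivity of the error: a zero error would make `ξ 0` rational.
-/
theorem approxSystem_sim [NeZero n] (hξ : IntIndep ξ) :
    ApproxSystem SimPoint.size (SimPoint.error ξ) where
  finite Q c := by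
    refine ((finite_setOf_abs_le (max Q (‖ξ‖ * Q + c))).preimage
      (f := fun z : SimPoint n => z.1) Subtype.val_injective.injOn).subset ?_
    rintro z ⟨hQ, hc⟩ (i | j)
    · exact hQ.trans (le_max_left _ _)
    · refine le_trans ?_ (le_max_right _ _)
      have h1 : |ξ j * z.1 (Sum.inl ()) - z.1 (Sum.inr j)| ≤ c := (norm_le_pi_norm _ j).trans hc
      have h2 : |ξ j * z.1 (Sum.inl ())| ≤ ‖ξ‖ * Q := by
        rw [abs_mul]
        exact mul_le_mul (norm_le_pi_norm ξ j) hQ (abs_nonneg _) (norm_nonneg _)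
      rw [abs_sub_comm] at h1
      have := abs_sub_abs_le_abs_sub (z.1 (Sum.inr j) : ℝ) (ξ j * z.1 (Sum.inl ()))
      linarith
  exists_small := exists_error_lt (by have := NeZero.pos n; positivity) fun X hX =>
    exists_simPoint ξ hX
  pos z := by
    refine norm_pos_iff.mpr fun h => z.2 ?_
    have h0 := congrFun h 0
    simp only [simErr, Pi.zero_apply] at h0
    have := hξ (Sum.elim (fun _ => -z.1 (Sum.inr 0)) (Pi.single 0 (z.1 (Sum.inl ())))) (by
      simp only [linValue, Sum.elim_inl, Sum.elim_inr, Pi.single_apply]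
      push_cast
      simp
      linarith)
    simpa using congrFun this (Sum.inr 0)

theorem approxSystem_lin [NeZero n] (hξ : IntIndep ξ) :
    ApproxSystem LinPoint.size (LinPoint.error ξ) where
  finite Q c := by
    refine ((finite_setOf_abs_le (max Q (c + n * (‖ξ‖ * Q)))).preimage
      (f := fun z : LinPoint n => z.1) Subtype.val_injective.injOn).subset ?_
    rintro z ⟨hQ, hc⟩ (i | j)
    · refine le_trans ?_ (le_max_right _ _)
      have h2 : |∑ j, ξ j * (z.1 (Sum.inr j) : ℝ)| ≤ n * (‖ξ‖ * Q) := by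
        calc _ ≤ ∑ j, |ξ j * (z.1 (Sum.inr j) : ℝ)| := Finset.abs_sum_le_sum_abs _ _
          _ ≤ ∑ j : Fin n, ‖ξ‖ * Q := by
              refine Finset.sum_le_sum fun j _ => ?_
              rw [abs_mul]
              exact mul_le_mul (norm_le_pi_norm ξ j) ((norm_le_pi_norm (tailVec z.1) j).trans hQ)
                (abs_nonneg _) (norm_nonneg _)
          _ = _ := by simp
      have h1 : |(z.1 (Sum.inl ()) : ℝ) + ∑ j, ξ j * (z.1 (Sum.inr j) : ℝ)| ≤ c := hc
      have h3 := abs_sub_abs_le_abs_add (z.1 (Sum.inl ()) : ℝ)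
        (∑ j, ξ j * (z.1 (Sum.inr j) : ℝ))
      change |(z.1 (Sum.inl ()) : ℝ)| ≤ _
      linarith
    · exact ((norm_le_pi_norm (tailVec z.1) j).trans hQ).trans (le_max_left _ _)
  exists_small := exists_error_lt (by have := NeZero.pos n; positivity) fun X hX =>
    exists_linPoint ξ hX
  pos z := by
    refine abs_pos.mpr fun h => z.2 ?_
    rw [hξ _ h]
    ext j
    simp [tailVec]

end forms

/-! ### The four transference inequalities -/

theorem eventually_mul_rpow_le {p q : ℝ} (hpq : p < q) (K : ℝ) :
    ∀ᶠ X : ℝ in atTop, K * X ^ p ≤ X ^ q := by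
  filter_upwards [eventually_gt_atTop 0,
    (tendsto_rpow_atTop (sub_pos.mpr hpq)).eventually_ge_atTop K] with X hX hK
  calc K * X ^ p ≤ X ^ (q - p) * X ^ p := by gcongr
    _ = X ^ q := by rw [← Real.rpow_add hX]; congr 1; ring

theorem exists_minor_ne_zero {n : ℕ} {u₀ v₀ : ℝ} {u₁ v₁ : Fin n → ℝ}
    (h : |u₀| * ‖v₁‖ ≠ ‖u₁‖ * |v₀|) : ∃ j, u₀ * v₁ j - u₁ j * v₀ ≠ 0 := by
  by_contra! hc
  apply h
  have : u₀ • v₁ = v₀ • u₁ := by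
    ext j
    simp only [Pi.smul_apply, smul_eq_mul]
    linarith [hc j]
  have := congrArg norm this
  rw [norm_smul, norm_smul, Real.norm_eq_abs, Real.norm_eq_abs] at this
  rw [this, mul_comm]

theorem abs_minor_le {n : ℕ} (u₀ v₀ : ℝ) (u₁ v₁ : Fin n → ℝ) (j : Fin n) :
    |u₀ * v₁ j - u₁ j * v₀| ≤ |u₀| * ‖v₁‖ + ‖u₁‖ * |v₀| := by
  refine (abs_sub _ _).trans ?_
  rw [abs_mul, abs_mul]
  gcongr
  · exact norm_le_pi_norm v₁ j
  · exact norm_le_pi_norm u₁ j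

section

variable {n : ℕ} {ξ : Fin n → ℝ}

theorem solvable_lin_of_ne_zero {z : Unit ⊕ Fin n → ℤ} (hz : z ≠ 0) {w H : ℝ} (hH : 1 < H)
    (hw : 0 < w) (h0 : |linValue ξ z| ≤ H ^ (-w)) (h1 : ∀ j, |tailVec z j| ≤ H) :
    Solvable LinPoint.size (LinPoint.error ξ) w H :=
  ⟨⟨z, linPoint_of_ne_zero ξ hz
    (h0.trans_lt (Real.rpow_lt_one_of_one_lt_of_neg hH (neg_lt_zero.mpr hw)))⟩,
    (pi_norm_le_iff_of_nonneg (by linarith)).2 h1, h0⟩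

theorem solvable_sim_of_ne_zero {z : Unit ⊕ Fin n → ℤ} (hz : z ≠ 0) {μ X : ℝ} (hX : 1 < X)
    (hμ : 0 < μ) (h0 : |(z (Sum.inl ()) : ℝ)| ≤ X) (h1 : ∀ j, |simErr ξ z j| ≤ X ^ (-μ)) :
    Solvable SimPoint.size (SimPoint.error ξ) μ X := by
  have h2 : ‖simErr ξ z‖ ≤ X ^ (-μ) := (pi_norm_le_iff_of_nonneg (by positivity)).2 h1
  exact ⟨⟨z, simPoint_of_ne_zero ξ hz
    (h2.trans_lt (Real.rpow_lt_one_of_one_lt_of_neg hX (neg_lt_zero.mpr hμ)))⟩, h0, h2⟩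

/-- Both terms of each minor are at most `N v' * L v`. As `N v * L v' < N v' * L v`, the norms rule
out proportionality, so some minor survives. -/
theorem sim_pair_minors {v v' : SimPoint n}
    (hp : MinimalPair SimPoint.size (SimPoint.error ξ) v v') :
    (∀ j, |(v'.1 (Sum.inl ()) : ℝ) * (-simErr ξ v.1) j - (-simErr ξ v'.1) j * v.1 (Sum.inl ())| ≤
      2 * (v'.size * v.error ξ)) ∧
    ∃ j, (v'.1 (Sum.inl ()) : ℝ) * (-simErr ξ v.1) j - (-simErr ξ v'.1) j * v.1 (Sum.inl ()) ≠ 0 := by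
  have h1 := hp.size_lt
  have h2 := hp.error_lt
  have h3 : 0 ≤ v.size := abs_nonneg _
  have h4 : 0 ≤ v'.error ξ := norm_nonneg _
  have h5 : v'.error ξ * v.size < v'.size * v.error ξ := by nlinarith
  simp only [SimPoint.size, SimPoint.error] at *
  refine ⟨fun j => (abs_minor_le _ _ _ _ j).trans ?_, exists_minor_ne_zero ?_⟩ <;>
    rw [norm_neg, norm_neg]
  · linarith
  · exact h5.ne'

theorem lin_pair_minors {v v' : LinPoint n}
    (hp : MinimalPair LinPoint.size (LinPoint.error ξ) v v') :
    (∀ j, |linValue ξ v.1 * (-tailVec v'.1) j - (-tailVec v.1) j * linValue ξ v'.1| ≤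
      2 * (v'.size * v.error ξ)) ∧
    ∃ j, linValue ξ v.1 * (-tailVec v'.1) j - (-tailVec v.1) j * linValue ξ v'.1 ≠ 0 := by
  have h1 := hp.size_lt
  have h2 := hp.error_lt
  have h3 : 0 ≤ v.size := norm_nonneg _
  have h4 : 0 ≤ v'.error ξ := abs_nonneg _
  have h5 : v.size * v'.error ξ < v.error ξ * v'.size := by nlinarith
  simp only [LinPoint.size, LinPoint.error] at *
  refine ⟨fun j => (abs_minor_le _ _ _ _ j).trans ?_, exists_minor_ne_zero ?_⟩ <;>
    rw [norm_neg, norm_neg]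
  · linarith
  · exact h5.ne'

theorem SimPoint.size_pos (z : SimPoint n) : 0 < z.size :=
  abs_pos.mpr (Int.cast_ne_zero.mpr z.2)

/-- The uniform exponent of simultaneous approximation is at most `1`. -/
theorem uniform_sim_le_one [NeZero n] (hξ : IntIndep ξ) {h : ℝ}
    (hunif : ∀ᶠ X in atTop, Solvable SimPoint.size (SimPoint.error ξ) h X) : h ≤ 1 := by
  by_contra! h1
  obtain ⟨Q, hQ⟩ := eventually_atTop.mp hunif
  obtain ⟨R, hR⟩ := eventually_atTop.mp
    ((tendsto_rpow_neg_atTop (sub_pos.mpr h1)).eventually_lt_const (show (0 : ℝ) < 1 / 2 by norm_num))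
  obtain ⟨X, v, v', hp, -, -, hv'⟩ :=
    ((approxSystem_sim hξ).exists_pair_below (max (max Q 1 + 1) R)).exists
  obtain ⟨hmin, j, hj⟩ := sim_pair_minors hp
  have hv'0 := v'.size_pos
  have hL : v.error ξ ≤ v'.size ^ (-h) :=
    hp.error_le_rpow (Q := max Q 1) (by positivity)
      (fun X hX => hQ X ((le_max_left _ _).trans hX))
      (by have := (le_max_left _ _).trans hv'; linarith)
  have h2 := hR _ ((le_max_right _ _).trans hv')
  have h3 : v'.size * v'.size ^ (-h) = v'.size ^ (-(h - 1)) := by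
    rw [show -(h - 1) = 1 + -h by ring, Real.rpow_add hv'0, Real.rpow_one]
  have h4 : |(v'.1 (Sum.inl ()) : ℝ) * (-simErr ξ v.1) j -
      (-simErr ξ v'.1) j * v.1 (Sum.inl ())| < 1 := by
    refine (hmin j).trans_lt ?_
    have := mul_le_mul_of_nonneg_left hL hv'0.le
    linarith
  -- The terms in `ξ` cancel: the minor is a nonzero integer, yet smaller than `1` if `h > 1`.
  have h5 : (v'.1 (Sum.inl ()) : ℝ) * (-simErr ξ v.1) j - (-simErr ξ v'.1) j * v.1 (Sum.inl ()) =
      ((v'.1 (Sum.inl ()) * v.1 (Sum.inr j) - v'.1 (Sum.inr j) * v.1 (Sum.inl ()) : ℤ) : ℝ) := by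
    simp only [simErr, Pi.neg_apply]
    push_cast
    ring
  rw [h5] at h4 hj
  exact hj (by exact_mod_cast Int.abs_lt_one_iff.mp (by exact_mod_cast h4))

/-- Transference from simultaneous approximation to linear forms, ordinary exponents. -/
theorem frequently_lin_of_sim (hn : 2 ≤ n) (hξ : IntIndep ξ) {l h b : ℝ} (hb : 0 < b)
    (hh : h < 1) (hl : 0 ≤ l)
    (hfreq : ∃ᶠ X in atTop, Solvable SimPoint.size (SimPoint.error ξ) l X)
    (hunif : ∀ᶠ X in atTop, Solvable SimPoint.size (SimPoint.error ξ) h X)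
    (hlt : 1 - h < b * ((n - 1) * l + h + n - 2)) :
    ∃ᶠ H in atTop, Solvable LinPoint.size (LinPoint.error ξ) (1 / b) H := by
  have : NeZero n := ⟨by omega⟩
  have hn' : (2 : ℝ) ≤ n := by exact_mod_cast hn
  have hn0 : (0 : ℝ) < n := by linarith
  have hn1 : (0 : ℝ) < n - 1 := by linarith
  -- With `Y` the size of `v'`, the dual point has height at most `Y ^ s` and value of order at most
  -- `Y ^ (s - l - 1)`. The lower bound on `s` makes room for the minors, of order at most `Y ^ (1 -
  -- h)`; the upper one makes the value at most `(Y ^ s) ^ (-1/b)`. Such an `s` exists exactly under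
  -- `hlt`.
  obtain ⟨s, hs1, hs2⟩ : ∃ s, (1 - h) / (n - 1) < s ∧ s < (1 + l) * b / (b + 1) := by
    refine exists_between ?_
    rw [div_lt_div_iff₀ hn1 (by linarith)]
    nlinarith
  have hs0 : 0 < s := lt_trans (div_pos (by linarith) hn1) hs1
  rw [div_lt_iff₀ hn1] at hs1
  rw [lt_div_iff₀ (by linarith)] at hs2
  rw [frequently_atTop]
  intro R
  obtain ⟨Q, hQ⟩ := eventually_atTop.mp hunif
  obtain ⟨R₁, hR₁⟩ := eventually_atTop.mp
    ((eventually_mul_rpow_le hs1 (8 * n ^ (n - 1))).and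
    ((eventually_mul_rpow_le (p := s - l) (q := 1 - s / b) (by
      have : s / b * b = s := by field_simp
      by_contra! hc
      nlinarith) n).and
    ((tendsto_rpow_atTop hs0).eventually_ge_atTop (max R 2))))
  obtain ⟨X, hX, ⟨v, v', hp, hv'X, hv'min, hv'⟩, hX1⟩ := (hfreq.and_eventually
    (((approxSystem_sim hξ).exists_pair_below (max (max Q 1 + 1) R₁)).and
      (eventually_ge_atTop 1))).exists
  obtain ⟨hA, hB, hC⟩ := hR₁ _ ((le_max_right _ _).trans hv')
  have hv'0 := v'.size_pos
  have hL : v.error ξ ≤ v'.size ^ (-h) :=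
    hp.error_le_rpow (Q := max Q 1) (by positivity)
      (fun X hX => hQ X ((le_max_left _ _).trans hX))
      (by have := (le_max_left _ _).trans hv'; linarith)
  have hL' : v'.error ξ ≤ v'.size ^ (-l) := by
    obtain ⟨w, hw1, hw2⟩ := hX
    exact ((hv'min w hw1).trans hw2).trans
      (Real.rpow_le_rpow_of_nonpos hv'0 hv'X (by linarith))
  set Y := v'.size with hY
  obtain ⟨hD, hne⟩ := sim_pair_minors hp
  obtain ⟨z, hz, h0, h1⟩ := exists_orthogonal_two (c := Y ^ s / n) (abs_det_linMatrix ξ)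
    (integralForm_lin ξ v'.1) (integralForm_lin ξ v.1) (by positivity) hD hne (by
      have h3 : Y * Y ^ (-h) = Y ^ (1 - h) := by
        rw [sub_eq_add_neg, Real.rpow_add hv'0, Real.rpow_one]
      have h4 : Y * v.error ξ ≤ Y ^ (1 - h) := by
        rw [← h3]; gcongr
      have h5 : (Y ^ s) ^ (n - 1) = Y ^ (s * (n - 1)) := by
        rw [← Real.rpow_natCast, ← Real.rpow_mul hv'0.le, Nat.cast_sub (by omega)]; simp
      rw [div_pow, le_div_iff₀ (by positivity), h5]
      refine le_trans ?_ hA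
      have : (0 : ℝ) ≤ n ^ (n - 1) := by positivity
      nlinarith)
  simp only [linMatrix_mulVec_inl, linMatrix_mulVec_inr] at h0 h1
  have h1' : ∀ j, |tailVec z j| ≤ Y ^ s := fun j => (h1 j).trans_eq (by field_simp)
  refine ⟨Y ^ s, (le_max_left _ _).trans hC, solvable_lin_of_ne_zero hz
    (by have := (le_max_right _ _).trans hC; linarith) (by positivity) ?_ h1'⟩
  have h2 := abs_mul_le_of_orthogonal (U := v'.error ξ) (fun j => by
    have := norm_le_pi_norm (simErr ξ v'.1) j
    simpa [SimPoint.error] using this) h0 h1'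
  rw [← Real.rpow_mul hv'0.le]
  refine le_of_mul_le_mul_left (a := Y) ?_ hv'0
  calc Y * |linValue ξ z| ≤ n * (v'.error ξ * Y ^ s) := h2
    _ ≤ n * (Y ^ (-l) * Y ^ s) := by gcongr
    _ = n * Y ^ (s - l) := by rw [← Real.rpow_add hv'0]; congr 2; ring
    _ ≤ Y ^ (1 - s / b) := hB
    _ = Y * Y ^ (s * -(1 / b)) := by
        rw [show 1 - s / b = 1 + s * -(1 / b) by ring, Real.rpow_add hv'0, Real.rpow_one]

/-- Transference from simultaneous approximation to linear forms, uniform exponents. -/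
theorem eventually_lin_of_sim (hn : 2 ≤ n) (hξ : IntIndep ξ) {h a : ℝ} (ha : 0 < a)
    (hh : h < 1) (hunif : ∀ᶠ X in atTop, Solvable SimPoint.size (SimPoint.error ξ) h X)
    (hlt : 1 - h < a * (n - 1)) :
    ∀ᶠ H in atTop, Solvable LinPoint.size (LinPoint.error ξ) (1 / a) H := by
  have : NeZero n := ⟨by omega⟩
  have hn' : (2 : ℝ) ≤ n := by exact_mod_cast hn
  have hn0 : (0 : ℝ) < n := by linarith
  have hh' : 0 < 1 - h := by linarith
  -- The minimal points are taken up to `X = H ^ s`. The target value is of order `1 / X`, below `H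
  -- ^ (-1/a)`, and minors of order `X ^ (1 - h)` must fit into `H ^ (n - 1)`.
  obtain ⟨s, hs1, hs2⟩ : ∃ s, 1 / a < s ∧ s < (n - 1) / (1 - h) := by
    refine exists_between ?_
    rw [div_lt_div_iff₀ ha hh']
    linarith
  have hs0 : 0 < s := lt_trans (by positivity) hs1
  rw [lt_div_iff₀ hh'] at hs2
  obtain ⟨Q, hQ⟩ := eventually_atTop.mp hunif
  filter_upwards [eventually_gt_atTop 1,
    eventually_mul_rpow_le hs2 (8 * n ^ (n - 1)),
    eventually_mul_rpow_le (p := -s) (q := -(1 / a)) (by linarith) (n ^ 2),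
    (tendsto_rpow_atTop hs0).eventually (hunif.and
      ((approxSystem_sim hξ).exists_pair_below (max Q 1 + 1)))]
    with H hH hA hB ⟨hX, v, v', hp, hv'X, hv'min, hv'⟩
  have hH0 : 0 < H := by linarith
  have hv'0 := v'.size_pos
  have hL : v.error ξ ≤ v'.size ^ (-h) :=
    hp.error_le_rpow (Q := max Q 1) (by positivity)
      (fun X hX => hQ X ((le_max_left _ _).trans hX)) (by linarith)
  have hL' : v'.error ξ ≤ (H ^ s) ^ (-h) := by
    obtain ⟨w, hw1, hw2⟩ := hX
    exact (hv'min w hw1).trans hw2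
  set X := H ^ s with hXdef
  have hX0 : 0 < X := by positivity
  have hXh : X ^ (1 - h) = H ^ (s * (1 - h)) := by rw [hXdef, ← Real.rpow_mul hH0.le]
  have hc : 8 * X ^ (1 - h) ≤ (H / n) ^ (n - 1) := by
    have h5 : H ^ (n - 1) = H ^ ((n : ℝ) - 1) := by
      rw [← Real.rpow_natCast, Nat.cast_sub (by omega)]; simp
    rw [div_pow, le_div_iff₀ (by positivity), h5, hXh]
    linarith
  obtain ⟨hD, hne⟩ := sim_pair_minors hp
  obtain ⟨z, hz, h0, h1⟩ := exists_small_of_pair (c := H / n) (ε := X⁻¹) (abs_det_linMatrix ξ)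
    (integralForm_lin ξ v'.1) (integralForm_lin ξ v.1) (by positivity) (by positivity) hD hne
    (Int.cast_ne_zero.mpr v'.2)
    (by rw [norm_neg]; exact (approxSystem_sim hξ).pos v')
    (by
      have h3 : v'.size * v'.size ^ (-h) = v'.size ^ (1 - h) := by
        rw [sub_eq_add_neg, Real.rpow_add hv'0, Real.rpow_one]
      have h4 : v'.size * v.error ξ ≤ X ^ (1 - h) := by
        calc _ ≤ v'.size * v'.size ^ (-h) := by gcongr
          _ = v'.size ^ (1 - h) := h3
          _ ≤ _ := Real.rpow_le_rpow hv'0.le hv'X hh'.le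
      linarith)
    (by
      have h6 : X ^ (1 - h) * X⁻¹ = X ^ (-h) := by
        rw [← Real.rpow_neg_one, ← Real.rpow_add hX0]; congr 1; ring
      have h7 := mul_le_mul_of_nonneg_right hc (inv_nonneg.mpr hX0.le)
      rw [mul_assoc, h6] at h7
      have h8 : ‖-simErr ξ v'.1‖ ≤ X ^ (-h) := by rw [norm_neg]; exact hL'
      have : 0 ≤ X ^ (-h) := by positivity
      linarith)
  simp only [linMatrix_mulVec_inl, linMatrix_mulVec_inr] at h0 h1
  refine solvable_lin_of_ne_zero hz hH (by positivity) (h0.trans ?_)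
    (fun j => (h1 j).trans_eq (by field_simp))
  rwa [hXdef, ← Real.rpow_neg hH0.le]

/-- Transference from linear forms to simultaneous approximation, uniform exponents. -/
theorem eventually_sim_of_lin (hn : 2 ≤ n) (hξ : IntIndep ξ) {μ a : ℝ} (ha : 0 < a)
    (hμ : 0 < μ) (hunif : ∀ᶠ X in atTop, Solvable LinPoint.size (LinPoint.error ξ) (1 / a) X)
    (hlt : μ * (n - 1) < 1 - a) :
    ∀ᶠ X in atTop, Solvable SimPoint.size (SimPoint.error ξ) μ X := by
  have : NeZero n := ⟨by omega⟩
  have hn' : (2 : ℝ) ≤ n := by exact_mod_cast hn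
  have hn0 : (0 : ℝ) < n := by linarith
  have ha1 : a < 1 := by nlinarith
  obtain ⟨Q, hQ⟩ := eventually_atTop.mp hunif
  obtain ⟨w₀, -⟩ := (approxSystem_lin hξ).exists_small 1 one_pos
  filter_upwards [eventually_gt_atTop 1,
    eventually_mul_rpow_le (p := a - 1) (q := -μ * (n - 1)) (by linarith) (8 * n ^ (n - 1)),
    eventually_mul_rpow_le (p := a) (q := -μ * (n - 1) + 1) (by linarith) (2 * n ^ 2 * n ^ (n - 1)),
    (tendsto_rpow_atTop ha).eventually (eventually_ge_atTop (max (max Q 1) w₀.size))]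
    with X hX hA hB hXa
  have hX0 : 0 < X := by linarith
  have hXa1 : max Q 1 ≤ X ^ a := (le_max_left _ _).trans hXa
  -- The threshold `X ^ a` balances two needs: the minors are of order at most `X ^ (a - 1)`, as `1
  -- - 1/a ≤ 0` and `v'` is larger than `X ^ a`, while `‖tailVec v‖ ≤ X ^ a`. Both conditions reduce
  -- to `hlt`.
  obtain ⟨v, v', hp, hv, hv'⟩ := (approxSystem_lin hξ).exists_pair_around
    (Q := X ^ a) ⟨w₀, (le_max_right _ _).trans hXa⟩
  have hXa0 : 0 < X ^ a := by positivity
  have hv'0 : 0 < v'.size := hXa0.trans hv'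
  have hL : v.error ξ ≤ v'.size ^ (-(1 / a)) :=
    hp.error_le_rpow hXa0
      (fun X hX => hQ X (((le_max_left _ _).trans hXa1).trans hX)) hv'
  have hc : (X ^ (-μ) / n) ^ (n - 1) = X ^ (-μ * (n - 1)) / n ^ (n - 1) := by
    rw [div_pow, ← Real.rpow_natCast, ← Real.rpow_mul hX0.le, Nat.cast_sub (by omega)]; simp
  obtain ⟨hD, hne⟩ := lin_pair_minors hp
  obtain ⟨z, hz, h0, h1⟩ := exists_small_of_pair (c := X ^ (-μ) / n) (ε := X / n ^ 2)
    (abs_det_simMatrix ξ) (integralForm_sim ξ v.1) (integralForm_sim ξ v'.1) (by positivity)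
    (by positivity) hD hne
    (abs_pos.mp ((approxSystem_lin hξ).pos v))
    (by rw [norm_neg]; exact norm_pos_iff.mpr v.2)
    (by
      have h4 : v'.size * v.error ξ ≤ X ^ (a - 1) := by
        calc _ ≤ v'.size * v'.size ^ (-(1 / a)) := by gcongr
          _ = v'.size ^ (1 + -(1 / a)) := by rw [Real.rpow_add hv'0, Real.rpow_one]
          _ ≤ (X ^ a) ^ (1 + -(1 / a)) := Real.rpow_le_rpow_of_nonpos hXa0 hv'.le (by
              have : 1 ≤ 1 / a := by rw [le_div_iff₀ ha]; linarith
              linarith)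
          _ = X ^ (a - 1) := by
              rw [← Real.rpow_mul hX0.le]; congr 1; field_simp
              ring
      rw [hc, le_div_iff₀ (by positivity)]
      refine le_trans ?_ hA
      have : (0 : ℝ) ≤ n ^ (n - 1) := by positivity
      nlinarith)
    (by
      rw [hc, norm_neg, div_mul_div_comm, le_div_iff₀ (by positivity)]
      rw [Real.rpow_add hX0, Real.rpow_one] at hB
      refine le_trans ?_ hB
      have h8 : ‖tailVec v.1‖ ≤ X ^ a := hv
      calc 2 * ‖tailVec v.1‖ * (n ^ (n - 1) * n ^ 2) ≤ 2 * X ^ a * (n ^ (n - 1) * n ^ 2) := by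
            gcongr
        _ = _ := by ring)
  simp only [simMatrix_mulVec_inl, simMatrix_mulVec_inr] at h0 h1
  exact solvable_sim_of_ne_zero hz hX hμ (h0.trans_eq (by field_simp))
    (fun j => (h1 j).trans_eq (by field_simp))

/-- Transference from linear forms to simultaneous approximation, ordinary exponents. -/
theorem frequently_sim_of_lin (hn : 2 ≤ n) (hξ : IntIndep ξ) {μ a b : ℝ} (ha : 0 < a)
    (hb : 0 < b) (hμ : 0 < μ)
    (hunif : ∀ᶠ X in atTop, Solvable LinPoint.size (LinPoint.error ξ) (1 / a) X)
    (hfreq : ∃ᶠ X in atTop, Solvable LinPoint.size (LinPoint.error ξ) (1 / b) X)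
    (hlt : μ * ((1 + b) * (n - 1) - (1 - a)) < 1 - a) :
    ∃ᶠ X in atTop, Solvable SimPoint.size (SimPoint.error ξ) μ X := by
  have : NeZero n := ⟨by omega⟩
  have hn' : (2 : ℝ) ≤ n := by exact_mod_cast hn
  have hn0 : (0 : ℝ) < n := by linarith
  have hn1 : (0 : ℝ) < n - 1 := by linarith
  -- Scales are powers of `Y = 1 / L v`: then `N v ≤ Y ^ b` and `N v' ≤ Y ^ a`. The errors are to be
  -- `Y ^ (-sμ)`, so the minors of order `Y ^ (a - 1)` bound `s` above, and the denominator, of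
  -- order `Y ^ (1 + b - sμ)`, is at most `Y ^ s` by the lower bound.
  obtain ⟨s, hs1, hs2⟩ : ∃ s, (1 + b) / (1 + μ) < s ∧ s < (1 - a) / (μ * (n - 1)) := by
    refine exists_between ?_
    rw [div_lt_div_iff₀ (by linarith) (by positivity)]
    linarith
  have hs0 : 0 < s := lt_trans (by positivity) hs1
  rw [div_lt_iff₀ (by linarith)] at hs1
  rw [lt_div_iff₀ (by positivity)] at hs2
  rw [frequently_atTop]
  intro R
  obtain ⟨Q, hQ⟩ := eventually_atTop.mp hunif
  obtain ⟨w₀, -⟩ := (approxSystem_lin hξ).exists_small 1 one_pos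
  obtain ⟨R₁, hR₁⟩ := eventually_atTop.mp
    ((eventually_gt_atTop 0).and
    ((eventually_mul_rpow_le (p := a - 1) (q := -(s * μ) * (n - 1)) (by linarith)
      (8 * n ^ (n - 1))).and
    ((eventually_mul_rpow_le (p := 1 + b - s * μ) (q := s) (by linarith) n).and
    ((tendsto_rpow_atTop hs0).eventually_ge_atTop (max R 2)))))
  have hb' : 0 < 1 / b := by positivity
  obtain ⟨X, ⟨w, hwX, hwL⟩, hX, hXb⟩ := (hfreq.and_eventually
    ((eventually_ge_atTop (max (max Q 1) w₀.size)).and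
      ((tendsto_rpow_atTop hb').eventually_ge_atTop R₁))).exists
  have hX1 : max Q 1 ≤ X := (le_max_left _ _).trans hX
  have hX0 : 0 < X := lt_of_lt_of_le one_pos ((le_max_right _ _).trans hX1)
  obtain ⟨v, v', hp, hv, hv'⟩ := (approxSystem_lin hξ).exists_pair_around
    (Q := X) ⟨w₀, (le_max_right _ _).trans hX⟩
  have hv'0 : 0 < v'.size := hX0.trans hv'
  have hL : v.error ξ ≤ v'.size ^ (-(1 / a)) :=
    hp.error_le_rpow hX0
      (fun X hX => hQ X (((le_max_left _ _).trans hX1).trans hX)) hv'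
  have hL' : v.error ξ ≤ X ^ (-(1 / b)) := (hp.error_le w (hwX.trans_lt hv')).trans hwL
  have hM : 0 < v.error ξ := (approxSystem_lin hξ).pos v
  set Y := (v.error ξ)⁻¹ with hY
  have hY0 : 0 < Y := inv_pos.mpr hM
  have hYX : X ^ (1 / b) ≤ Y := by
    rw [hY, ← inv_inv (X ^ (1 / b)), ← Real.rpow_neg hX0.le]
    exact inv_anti₀ hM hL'
  obtain ⟨-, hA, hB, hC⟩ := hR₁ Y (hXb.trans hYX)
  have hvY : v.size ≤ Y ^ b := by
    refine hv.trans ?_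
    have := Real.rpow_le_rpow (by positivity) hYX hb.le
    rwa [← Real.rpow_mul hX0.le, one_div_mul_cancel hb.ne', Real.rpow_one] at this
  have hv'Y : v'.size ≤ Y ^ a := by
    have h1 : v'.size ^ (1 / a) ≤ Y := by
      rw [hY, ← inv_inv (v'.size ^ (1 / a)), ← Real.rpow_neg hv'0.le]
      exact inv_anti₀ hM hL
    have := Real.rpow_le_rpow (by positivity) h1 ha.le
    rwa [← Real.rpow_mul hv'0.le, one_div_mul_cancel ha.ne', Real.rpow_one] at this
  have hc : (Y ^ (-(s * μ)) / n) ^ (n - 1) = Y ^ (-(s * μ) * (n - 1)) / n ^ (n - 1) := by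
    rw [div_pow, ← Real.rpow_natCast, ← Real.rpow_mul hY0.le, Nat.cast_sub (by omega)]; simp
  obtain ⟨hD, hne⟩ := lin_pair_minors hp
  obtain ⟨z, hz, h0, h1⟩ := exists_orthogonal_two (c := Y ^ (-(s * μ)) / n)
    (abs_det_simMatrix ξ) (integralForm_sim ξ v.1) (integralForm_sim ξ v'.1) (by positivity)
    hD hne
    (by
      have h4 : v'.size * v.error ξ ≤ Y ^ (a - 1) := by
        calc _ ≤ Y ^ a * v.error ξ := by gcongr
          _ = Y ^ a * Y ^ (-1 : ℝ) := by rw [Real.rpow_neg_one, hY, inv_inv]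
          _ = Y ^ (a - 1) := by rw [← Real.rpow_add hY0]; rfl
      rw [hc, le_div_iff₀ (by positivity)]
      refine le_trans ?_ hA
      have : (0 : ℝ) ≤ n ^ (n - 1) := by positivity
      nlinarith)
  simp only [simMatrix_mulVec_inl, simMatrix_mulVec_inr] at h0 h1
  have h1' : ∀ j, |simErr ξ z j| ≤ Y ^ (-(s * μ)) := fun j => (h1 j).trans_eq (by field_simp)
  have h2 := abs_mul_le_of_orthogonal (U := v.size) (fun j => by
    have := norm_le_pi_norm (tailVec v.1) j
    simpa [LinPoint.size] using this) h0 h1'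
  refine ⟨Y ^ s, (le_max_left _ _).trans hC, solvable_sim_of_ne_zero hz
    (by have := (le_max_right _ _).trans hC; linarith) hμ ?_ fun j => (h1' j).trans_eq ?_⟩
  · refine le_of_mul_le_mul_left (a := v.error ξ) ?_ hM
    calc v.error ξ * |(z (Sum.inl ()) : ℝ)| ≤ n * (v.size * Y ^ (-(s * μ))) := h2
      _ ≤ n * (Y ^ b * Y ^ (-(s * μ))) := by gcongr
      _ = Y⁻¹ * (n * Y ^ (1 + b - s * μ)) := by
          rw [show 1 + b - s * μ = 1 + (b + -(s * μ)) by ring, Real.rpow_add hY0 1, Real.rpow_one,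
            Real.rpow_add hY0]
          field_simp
      _ ≤ Y⁻¹ * Y ^ s := by gcongr
      _ = v.error ξ * Y ^ s := by rw [hY, inv_inv]
  · rw [← Real.rpow_mul hY0.le]
    congr 1
    ring

end

/-! ### Exponents as suprema -/

theorem simulSolvable_iff {N : ℕ} (ξ : Fin N → ℝ) (μ : ℝ) {X : ℝ} (hX : 0 ≤ X) :
    SimulSolvable ξ μ X ↔ Solvable SimPoint.size (SimPoint.error ξ) μ X := by
  constructor
  · rintro ⟨x, y, hx, hxX, hy⟩
    refine ⟨⟨Sum.elim (fun _ => x) y, fun h => ?_⟩, ?_, ?_⟩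
    · simp only [Sum.elim_inl] at h
      simp [h] at hx
    · simpa [SimPoint.size] using hxX
    · exact (pi_norm_le_iff_of_nonneg (by positivity)).2 hy
  · rintro ⟨z, h1, h2⟩
    refine ⟨z.1 (Sum.inl ()), fun j => z.1 (Sum.inr j), Int.one_le_abs z.2,
      by simpa [SimPoint.size] using h1,
      fun j => (norm_le_pi_norm (simErr ξ z.1) j).trans h2⟩

section exponents

variable {N : ℕ} {ξ : Fin N → ℝ} {μ : ℝ}

theorem le_uniformExponent
    (h : ∀ᶠ X in atTop, Solvable SimPoint.size (SimPoint.error ξ) μ X) :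
    (μ : EReal) ≤ uniformExponent ξ :=
  le_sSup ⟨μ, rfl, (h.and (eventually_ge_atTop 0)).mono fun _ hX =>
    (simulSolvable_iff ξ μ hX.2).2 hX.1⟩

theorem le_ordinaryExponent
    (h : ∃ᶠ X in atTop, Solvable SimPoint.size (SimPoint.error ξ) μ X) :
    (μ : EReal) ≤ ordinaryExponent ξ :=
  le_sSup ⟨μ, rfl, (h.and_eventually (eventually_ge_atTop 0)).mono fun _ hX =>
    (simulSolvable_iff ξ μ hX.2).2 hX.1⟩

theorem eventually_of_lt_uniformExponent (h : (μ : EReal) < uniformExponent ξ) :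
    ∀ᶠ X in atTop, Solvable SimPoint.size (SimPoint.error ξ) μ X := by
  obtain ⟨_, ⟨ν, rfl, hν⟩, hμν⟩ := lt_sSup_iff.mp h
  filter_upwards [hν, eventually_ge_atTop 1] with X hX hX1
  exact ((simulSolvable_iff ξ ν (by linarith)).1 hX).mono hX1 (EReal.coe_lt_coe_iff.mp hμν).le

theorem frequently_of_lt_ordinaryExponent (h : (μ : EReal) < ordinaryExponent ξ) :
    ∃ᶠ X in atTop, Solvable SimPoint.size (SimPoint.error ξ) μ X := by
  obtain ⟨_, ⟨ν, rfl, hν⟩, hμν⟩ := lt_sSup_iff.mp h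
  refine (hν.and_eventually (eventually_ge_atTop 1)).mono fun X ⟨hX, hX1⟩ => ?_
  exact ((simulSolvable_iff ξ ν (by linarith)).1 hX).mono hX1 (EReal.coe_lt_coe_iff.mp hμν).le

theorem uniformExponent_le_ordinaryExponent : uniformExponent ξ ≤ ordinaryExponent ξ :=
  sSup_le_sSup fun _ ⟨μ, he, h⟩ => ⟨μ, he, h.frequently⟩

theorem one_div_le_uniformExponent [NeZero N] : ((1 / N : ℝ) : EReal) ≤ uniformExponent ξ :=
  le_uniformExponent ((eventually_gt_atTop 1).mono fun _ hX => exists_simPoint ξ hX)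

theorem uniformExponent_le_one [NeZero N] (hξ : IntIndep ξ) : uniformExponent ξ ≤ 1 := by
  refine sSup_le ?_
  rintro _ ⟨μ, rfl, h⟩
  have := uniform_sim_le_one hξ ((h.and (eventually_ge_atTop 0)).mono fun _ hX =>
    (simulSolvable_iff ξ μ hX.2).1 hX.1)
  exact_mod_cast this

end exponents

/-! ### Linear independence and the passage from `n` to `k` coordinates -/

theorem intIndep_of_linearIndependent {k : ℕ} {ξ : Fin k → ℝ}
    (hξ : LinearIndependent ℚ (Fin.cons 1 ξ : Fin (k + 1) → ℝ)) : IntIndep ξ := by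
  intro a ha
  have h := Fintype.linearIndependent_iff.mp hξ
    (Fin.cons (a (Sum.inl ()) : ℚ) fun j => (a (Sum.inr j) : ℚ)) (by
      rw [Fin.sum_univ_succ]
      simp only [Fin.cons_zero, Fin.cons_succ, Rat.smul_def, mul_one, Rat.cast_intCast]
      rw [← ha, linValue]
      simp only [mul_comm])
  ext (i | j)
  · simpa using h 0
  · simpa using h j.succ

/-- Extension of an integral vector by zeros. -/
def padZero {n : ℕ} (k : ℕ) (a : Unit ⊕ Fin n → ℤ) : Unit ⊕ Fin k → ℤ :=
  Sum.elim (fun _ => a (Sum.inl ())) fun j => if h : (j : ℕ) < n then a (Sum.inr ⟨j, h⟩) else 0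

section pad

variable {n k : ℕ} (hnk : n ≤ k) (ξ : ℕ → ℝ)

include hnk

theorem linValue_padZero (a : Unit ⊕ Fin n → ℤ) :
    linValue (firstCoords ξ k) (padZero k a) = linValue (firstCoords ξ n) a := by
  let g : ℕ → ℝ := fun m => ξ m * ((if h : m < n then a (Sum.inr ⟨m, h⟩) else 0 : ℤ) : ℝ)
  have h1 : ∑ j : Fin n, firstCoords ξ n j * (a (Sum.inr j) : ℝ) = ∑ m ∈ Finset.range n, g m := by
    rw [← Fin.sum_univ_eq_sum_range]
    exact Finset.sum_congr rfl fun j _ => by simp [g, firstCoords]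
  have h2 : ∑ j : Fin k, firstCoords ξ k j * (padZero k a (Sum.inr j) : ℝ) =
      ∑ m ∈ Finset.range k, g m := by
    rw [← Fin.sum_univ_eq_sum_range]
    exact Finset.sum_congr rfl fun j _ => by simp [g, firstCoords, padZero]
  rw [linValue, linValue, h1, h2, ← Finset.sum_subset (Finset.range_mono hnk) fun m _ hm => by
    simp only [Finset.mem_range] at hm
    simp [g, hm]]
  simp [padZero]

theorem tailVec_padZero_castLE (a : Unit ⊕ Fin n → ℤ) (j : Fin n) :
    tailVec (padZero k a) (Fin.castLE hnk j) = tailVec a j := by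
  simp [tailVec, padZero]

theorem IntIndep.firstCoords_of_le (h : IntIndep (firstCoords ξ k)) :
    IntIndep (firstCoords ξ n) := by
  intro a ha
  have h0 := h (padZero k a) (by rw [linValue_padZero hnk, ha])
  ext (i | j)
  · exact congrFun h0 (Sum.inl i)
  · have := congrFun h0 (Sum.inr (Fin.castLE hnk j))
    simpa [padZero] using this

theorem Solvable.lin_of_le {w H : ℝ}
    (h : Solvable LinPoint.size (LinPoint.error (firstCoords ξ n)) w H) :
    Solvable LinPoint.size (LinPoint.error (firstCoords ξ k)) w H := by
  obtain ⟨a, h1, h2⟩ := h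
  refine ⟨⟨padZero k a.1, fun h0 => a.2 ?_⟩, ?_, ?_⟩
  · ext j
    rw [← tailVec_padZero_castLE hnk, h0]
    rfl
  · refine le_trans ?_ h1
    refine (pi_norm_le_iff_of_nonneg (norm_nonneg _)).2 fun j => ?_
    by_cases hj : (j : ℕ) < n
    · have := norm_le_pi_norm (tailVec a.1) ⟨j, hj⟩
      rwa [← tailVec_padZero_castLE hnk] at this
    · simp [tailVec, padZero, hj]
  · change |linValue _ (padZero k a.1)| ≤ _
    rwa [linValue_padZero hnk]

end pad

/-! ### Transference in terms of exponents -/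

section transference

variable {n : ℕ} {ξ : Fin n → ℝ} {h : ℝ}

theorem frequently_lin_of_exponents (hn : 2 ≤ n) (hξ : IntIndep ξ)
    (hh : uniformExponent ξ = h) (hh1 : h ≤ 1) {l b : ℝ} (hl0 : 0 < l) (hb : 0 < b)
    (hl : (l : EReal) ≤ ordinaryExponent ξ) (hlt : 1 - h < b * ((n - 1) * l + h + n - 2)) :
    ∃ᶠ H in atTop, Solvable LinPoint.size (LinPoint.error ξ) (1 / b) H := by
  have hn' : (2 : ℝ) ≤ n := by exact_mod_cast hn
  have hbn : 0 < 1 + b * n := by positivity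
  -- The suprema need not be attained, so `l` and `h` are lowered by `t`; this costs `t * (1 + b *
  -- n)` in the strict inequality.
  obtain ⟨t, ht0, ht⟩ := exists_between (lt_min hl0 (div_pos (sub_pos.mpr hlt) hbn))
  have ht2 := ht.trans_le (min_le_right _ _)
  rw [lt_div_iff₀ hbn] at ht2
  refine frequently_lin_of_sim (l := l - t) (h := h - t) hn hξ hb (by linarith)
    (by linarith [ht.trans_le (min_le_left _ _)])
    (frequently_of_lt_ordinaryExponent
      ((EReal.coe_lt_coe_iff.mpr (by linarith)).trans_le hl))
    (eventually_of_lt_uniformExponent (by rw [hh]; exact EReal.coe_lt_coe_iff.mpr (by linarith)))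
    ?_
  linarith

theorem eventually_lin_of_exponent (hn : 2 ≤ n) (hξ : IntIndep ξ)
    (hh : (h : EReal) ≤ uniformExponent ξ) (hh1 : h ≤ 1) {a : ℝ} (ha : 0 < a)
    (hlt : 1 - h < a * (n - 1)) :
    ∀ᶠ H in atTop, Solvable LinPoint.size (LinPoint.error ξ) (1 / a) H := by
  obtain ⟨t, ht0, ht⟩ := exists_between (sub_pos.mpr hlt)
  exact eventually_lin_of_sim (h := h - t) hn hξ ha (by linarith)
    (eventually_of_lt_uniformExponent ((EReal.coe_lt_coe_iff.mpr (by linarith)).trans_le hh))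
    (by linarith)

theorem eventually_lin_dirichlet [NeZero n] {a : ℝ} (ha : 1 / n < a) :
    ∀ᶠ H in atTop, Solvable LinPoint.size (LinPoint.error ξ) (1 / a) H := by
  have hn : (0 : ℝ) < n := by exact_mod_cast NeZero.pos n
  have ha0 : 0 < a := lt_trans (by positivity) ha
  filter_upwards [eventually_gt_atTop 1] with H hH
  refine (exists_linPoint ξ hH).mono hH.le ?_
  rw [div_lt_iff₀ hn] at ha
  rw [div_le_iff₀ ha0]
  linarith

/-- The lower bound for the ordinary exponent of simultaneous approximation in terms of the
inverses `a₀`, `b₀` of the exponents of approximation by linear forms. -/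
theorem le_ordinaryExponent_of_lin (hn : 2 ≤ n) (hξ : IntIndep ξ) {a₀ b₀ : ℝ} (ha₀ : 0 ≤ a₀)
    (hb₀ : 0 ≤ b₀)
    (ha : ∀ a > a₀, ∀ᶠ H in atTop, Solvable LinPoint.size (LinPoint.error ξ) (1 / a) H)
    (hb : ∀ b > b₀, ∃ᶠ H in atTop, Solvable LinPoint.size (LinPoint.error ξ) (1 / b) H)
    {r : EReal}
    (hr : ∀ μ : ℝ, 0 < μ → (μ : EReal) < r → μ * ((1 + b₀) * (n - 1) - (1 - a₀)) < 1 - a₀) :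
    r ≤ ordinaryExponent ξ := by
  have : NeZero n := ⟨by omega⟩
  have hn' : (2 : ℝ) ≤ n := by exact_mod_cast hn
  by_contra! hlt
  obtain ⟨μ, hμ, hμr⟩ := EReal.lt_iff_exists_real_btwn.mp hlt
  have h1 : ((1 / n : ℝ) : EReal) < μ :=
    (one_div_le_uniformExponent.trans uniformExponent_le_ordinaryExponent).trans_lt hμ
  -- A `μ` above the exponent exceeds the Dirichlet value `1 / n`, which is why `hr` is needed only
  -- for positive `μ`. Stated without division, `hr` also covers `r = ⊤`.
  have hμ0 : 0 < μ := lt_trans (by positivity) (EReal.coe_lt_coe_iff.mp h1)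
  have hpos : 0 < μ * n + 1 := by positivity
  obtain ⟨t, ht0, ht⟩ := exists_between (div_pos (sub_pos.mpr (hr μ hμ0 hμr)) hpos)
  rw [lt_div_iff₀ hpos] at ht
  refine hμ.not_ge (le_ordinaryExponent (frequently_sim_of_lin (a := a₀ + t) (b := b₀ + t) hn hξ
    (by linarith) (by linarith) hμ0 (ha _ (by linarith)) (hb _ (by linarith)) ?_))
  linarith

end transference

/-- The chain of uniform exponents: linear forms in dimension `n`, padded to `k`, then simultaneous
approximation in dimension `k`, then linear forms again. The inverses satisfy `a' > (1 - h)/(n -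
1)`, `μ < (1 - a')/(k - 1)`, `a > (1 - μ)/(k - 1)`; in the limit of equality `a = 1/A`. -/
theorem eventually_lin_going_up {n k : ℕ} (hn : 2 ≤ n) (hnk : n ≤ k) {ξ : ℕ → ℝ}
    (hξ : IntIndep (firstCoords ξ k)) {h : ℝ} (hh : uniformExponent (firstCoords ξ n) = h)
    (hh0 : 0 < h) (hh1 : h ≤ 1) {a : ℝ}
    (ha : ((n : ℝ) * k - k - 2 * n + 3 - h) / ((n - 1) * (k - 1) ^ 2) < a) :
    ∀ᶠ H in atTop, Solvable LinPoint.size (LinPoint.error (firstCoords ξ k)) (1 / a) H := by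
  have hn' : (2 : ℝ) ≤ n := by exact_mod_cast hn
  have hk' : (n : ℝ) ≤ k := by exact_mod_cast hnk
  have hn1 : (0 : ℝ) < n - 1 := by linarith
  have hk1 : (0 : ℝ) < k - 1 := by linarith
  have hpos : (0 : ℝ) < (n - 1) * (k - 1) ^ 2 := by positivity
  have ha0 : 0 < a := by
    refine lt_of_le_of_lt (div_nonneg ?_ hpos.le) ha
    nlinarith
  rw [div_lt_iff₀ hpos] at ha
  obtain ⟨a', ha1, ha2⟩ : ∃ a', (1 - h) / (n - 1) < a' ∧
      a' < min 1 (1 - (k - 1) * (1 - a * (k - 1))) := by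
    refine exists_between (lt_min ?_ ?_) <;> rw [div_lt_iff₀ hn1] <;> nlinarith
  have ha0' : 0 < a' := lt_of_le_of_lt (div_nonneg (by linarith) hn1.le) ha1
  have ha3 := ha2.trans_le (min_le_left _ _)
  have ha4 := ha2.trans_le (min_le_right _ _)
  obtain ⟨μ, hμ1, hμ2⟩ : ∃ μ, max 0 (1 - a * (k - 1)) < μ ∧ μ < (1 - a') / (k - 1) := by
    refine exists_between (max_lt (div_pos (by linarith) hk1) ?_)
    rw [lt_div_iff₀ hk1]
    linarith
  have hμ0 := (le_max_left _ _).trans_lt hμ1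
  have hμ3 := (le_max_right _ _).trans_lt hμ1
  rw [lt_div_iff₀ hk1] at hμ2
  rw [div_lt_iff₀ hn1] at ha1
  have hlin := (eventually_lin_of_exponent hn (hξ.firstCoords_of_le hnk) hh.ge hh1 ha0' ha1).mono
    fun H hH => hH.lin_of_le hnk
  exact eventually_lin_of_sim (hn.trans hnk) hξ ha0 (by nlinarith)
    (eventually_sim_of_lin (hn.trans hnk) hξ ha0' hμ0 hlin hμ2) (by linarith)

/-! ### The two bounds -/

theorem mainTheorem7 (k n : ℕ) (hn : 2 ≤ n) (hnk : n ≤ k) (ξ : ℕ → ℝ)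
    (hξ : LinearIndependent ℚ (Fin.cons 1 (firstCoords ξ k) : Fin (k + 1) → ℝ)) :
    ∃ h : ℝ, uniformExponent (firstCoords ξ n) = (h : EReal) ∧ 1 / (n : ℝ) ≤ h ∧ h ≤ 1 ∧
      firstBound k n (ordinaryExponent (firstCoords ξ n)) h ≤
        ordinaryExponent (firstCoords ξ k) ∧
      secondBound k (quantityA k n h) (quantityB n (ordinaryExponent (firstCoords ξ n)) h) ≤
        ordinaryExponent (firstCoords ξ k) := by
  have : NeZero n := ⟨by omega⟩
  have : NeZero k := ⟨by omega⟩
  have hn' : (2 : ℝ) ≤ n := by exact_mod_cast hn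
  have hk' : (n : ℝ) ≤ k := by exact_mod_cast hnk
  have hn1 : (0 : ℝ) < n - 1 := by linarith
  have hk1 : (0 : ℝ) < k - 1 := by linarith
  have hk0 : (0 : ℝ) < k := by linarith
  have hk := intIndep_of_linearIndependent hξ
  have hI := hk.firstCoords_of_le hnk
  have hlow : ((1 / n : ℝ) : EReal) ≤ uniformExponent (firstCoords ξ n) :=
    one_div_le_uniformExponent
  have hup := uniformExponent_le_one hI
  obtain ⟨h, hh⟩ : ∃ h : ℝ, uniformExponent (firstCoords ξ n) = h :=
    ⟨_, (EReal.coe_toReal (fun ht => by rw [ht] at hup; exact absurd hup (by decide))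
      (fun hb => by rw [hb] at hlow; exact absurd hlow (by simp))).symm⟩
  have hhn : 1 / (n : ℝ) ≤ h := by rw [hh] at hlow; exact_mod_cast hlow
  have hh1 : h ≤ 1 := by rw [hh] at hup; exact_mod_cast hup
  have hh0 : 0 < h := lt_of_lt_of_le (by positivity) hhn
  refine ⟨h, hh, hhn, hh1, ?_⟩
  have hlh : (h : EReal) ≤ ordinaryExponent (firstCoords ξ n) :=
    hh ▸ uniformExponent_le_ordinaryExponent
  set l := ordinaryExponent (firstCoords ξ n) with hl
  have hlbot : l ≠ ⊥ := fun hb => by rw [hb] at hlh; exact absurd hlh (by simp)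
  -- The ordinary exponent of linear forms is at least `1 / b₀`.
  obtain ⟨b₀, hb₀, hbtop, hbreal, hfreq⟩ : ∃ b₀ : ℝ, 0 ≤ b₀ ∧ (l = ⊤ → b₀ = 0) ∧
      (l ≠ ⊤ → 0 < (n - 1) * l.toReal + h + n - 2 ∧
        b₀ = (1 - h) / ((n - 1) * l.toReal + h + n - 2)) ∧
      ∀ b > b₀, ∃ᶠ H in atTop,
        Solvable LinPoint.size (LinPoint.error (firstCoords ξ k)) (1 / b) H := by
    by_cases htop : l = ⊤
    · refine ⟨0, le_rfl, fun _ => rfl, fun hne => absurd htop hne, fun b hb => ?_⟩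
      have hb2 : b * (2 / b) = 2 := by field_simp
      have h2b : 0 < 2 / b := by positivity
      -- When `l = ⊤` any real value is available; `2 / b` is large enough, as `b * (2 / b) = 2 > 1
      -- - h`.
      refine (frequently_lin_of_exponents (l := 2 / b) hn hI hh hh1 (by positivity) hb
        (by rw [← hl, htop]; exact le_top) ?_).mono fun H hH => hH.lin_of_le hnk
      have : b * (2 / b) ≤ b * ((n - 1) * (2 / b) + h + n - 2) := by
        gcongr
        nlinarith
      linarith
    · have hlr : ((l.toReal : ℝ) : EReal) = l := EReal.coe_toReal htop hlbot
      have hlh' : h ≤ l.toReal := by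
        rw [← hlr] at hlh; exact_mod_cast hlh
      have hpos : 0 < (n - 1) * l.toReal + h + n - 2 := by nlinarith
      refine ⟨_, div_nonneg (by linarith) hpos.le, fun ht => absurd ht htop,
        fun _ => ⟨hpos, rfl⟩, fun b hb => ?_⟩
      have hb' : 0 < b := lt_of_le_of_lt (div_nonneg (by linarith) hpos.le) hb
      rw [gt_iff_lt, div_lt_iff₀ hpos] at hb
      exact (frequently_lin_of_exponents hn hI hh hh1 (by linarith) hb' hlr.le hb).mono
        fun H hH => hH.lin_of_le hnk
  constructor
  · refine le_ordinaryExponent_of_lin (a₀ := 1 / k) (hn.trans hnk) hk (by positivity) hb₀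
      (fun a ha => eventually_lin_dirichlet ha) hfreq fun μ hμ hμr => ?_
    -- With `a₀ = 1 / k` both sides share the factor `(k - 1) / k`.
    have hkey : μ * (k * (1 + b₀) - 1) < 1 → μ * ((1 + b₀) * (k - 1) - (1 - 1 / k)) < 1 - 1 / k := by
      intro hlt
      have h1 : (1 - 1 / (k : ℝ)) = (k - 1) / k := by field_simp
      have h2 : μ * ((1 + b₀) * (k - 1) - (1 - 1 / k)) =
          (k - 1) / k * (μ * (k * (1 + b₀) - 1)) := by rw [h1]; field_simp
      rw [h2, h1]
      exact mul_lt_of_lt_one_right (by positivity) hlt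
    apply hkey
    rw [firstBound] at hμr
    split_ifs at hμr with htop
    · have := EReal.coe_lt_coe_iff.mp hμr
      rw [lt_div_iff₀ hk1] at this
      rw [hbtop htop]
      linarith
    · obtain ⟨hpos, hb⟩ := hbreal htop
      have := EReal.coe_lt_coe_iff.mp hμr
      rw [lt_div_iff₀ (by nlinarith)] at this
      rw [hb]
      refine lt_of_mul_lt_mul_right ?_ hpos.le
      rw [one_mul]
      refine lt_of_eq_of_lt ?_ this
      field_simp
      ring
  · have hdA : 0 ≤ (n : ℝ) * k - k - 2 * n + 3 - h := by nlinarith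
    have hnk0 : (0 : ℝ) < (n - 1) * (k - 1) ^ 2 := by positivity
    refine le_ordinaryExponent_of_lin (hn.trans hnk) hk (div_nonneg hdA hnk0.le) hb₀
      (fun a ha => eventually_lin_going_up hn hnk hk hh hh0 hh1 ha) hfreq fun μ hμ hμr => ?_
    -- In terms of `a₀ = 1/A` and `b₀ = 1/B`, with `0` for an infinite value, one inequality
    -- contains all the limiting conventions of `secondBound`.
    have hBcases : (quantityB n l h = ⊤ ∧ b₀ = 0) ∨
        ∃ B : ℝ, 0 < B ∧ quantityB n l h = B ∧ b₀ = B⁻¹ := by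
      by_cases htop : l = ⊤
      · exact Or.inl ⟨if_pos (Or.inl htop), hbtop htop⟩
      · obtain ⟨hpos, hb⟩ := hbreal htop
        rcases hh1.eq_or_lt with h1 | h1
        · exact Or.inl ⟨if_pos (Or.inr h1), by rw [hb, h1, sub_self, zero_div]⟩
        · exact Or.inr ⟨_, div_pos hpos (by linarith), if_neg (by simp [htop, h1.ne]),
            by rw [hb, inv_div]⟩
    obtain ⟨hA, hA'⟩ | ⟨A, hA0, hA, hA'⟩ : (quantityA k n h = ⊤ ∧
        ((n : ℝ) * k - k - 2 * n + 3 - h) / ((n - 1) * (k - 1) ^ 2) = 0) ∨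
        ∃ A : ℝ, 0 < A ∧ quantityA k n h = A ∧
          ((n : ℝ) * k - k - 2 * n + 3 - h) / ((n - 1) * (k - 1) ^ 2) = A⁻¹ := by
      by_cases h0 : (n : ℝ) * k - k - 2 * n + 3 - h = 0
      · exact Or.inl ⟨if_pos h0, by rw [h0, zero_div]⟩
      · exact Or.inr ⟨_, div_pos hnk0 (lt_of_le_of_ne hdA (Ne.symm h0)), if_neg h0,
          (inv_div _ _).symm⟩
    all_goals obtain ⟨hB, hB'⟩ | ⟨B, hB0, hB, hB'⟩ := hBcases
    all_goals rw [hA', hB']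
    all_goals rw [hA, hB, secondBound] at hμr
    · rw [if_pos rfl, if_pos rfl] at hμr
      split_ifs at hμr with hk2
      · subst hk2
        norm_num
      · have hk3 : (0 : ℝ) < k - 2 := by
          have : (3 : ℝ) ≤ k := by exact_mod_cast (by omega : 3 ≤ k)
          linarith
        have := EReal.coe_lt_coe_iff.mp hμr
        rw [lt_div_iff₀ hk3] at this
        linarith
    · rw [if_pos rfl, if_neg (EReal.coe_ne_top _), EReal.toReal_coe] at hμr
      have := EReal.coe_lt_coe_iff.mp hμr
      rw [lt_div_iff₀ (by nlinarith)] at this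
      refine lt_of_mul_lt_mul_right ?_ hB0.le
      refine lt_of_eq_of_lt ?_ (this.trans_eq (by ring))
      field_simp
      ring
    · rw [if_neg (EReal.coe_ne_top _), if_pos rfl, EReal.toReal_coe] at hμr
      have := EReal.coe_lt_coe_iff.mp hμr
      rw [lt_div_iff₀ (by nlinarith)] at this
      refine lt_of_mul_lt_mul_right ?_ hA0.le
      refine lt_of_eq_of_lt ?_ (this.trans_eq (by field_simp))
      field_simp
      ring
    · rw [if_neg (EReal.coe_ne_top _), if_neg (EReal.coe_ne_top _), EReal.toReal_coe,
        EReal.toReal_coe] at hμr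
      have := EReal.coe_lt_coe_iff.mp hμr
      have hk2 : (0 : ℝ) ≤ k - 2 := by linarith
      rw [lt_div_iff₀ (by positivity)] at this
      refine lt_of_mul_lt_mul_right ?_ (mul_pos hA0 hB0).le
      refine lt_of_eq_of_lt ?_ (this.trans_eq (by field_simp))
      field_simp
      ring
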